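/- For integers $m\geq 1$, $r$, $l\geq 0$ let $F_m$ be the free group of rank $m$, and let $\phi\colon F_m^{\times r}=F_m\times\dots\times F_m\to\mathbb{Z}^l$ be a homomorphism from the direct product of $r$ copies of $F_m$ whose restriction to each of the $r$ factors is surjective (so $m\geq l$). The kernel of such a $\phi$ is Dison's group $K_m^r(l)$; up to an automorphism of $F_m^{\times r}$ it does not depend on the choice of $\phi$. For a finite presentation $\langle X\mid R\rangle$ and a word $w$ in $X\sqcup X^{-1}$ that represents the trivial element, let $\mathrm{Area}(w)$ be the least $k$ such that $w=\prod_{i=1}^k w_ir_iw_i^{-1}$ in the free group $F(X)$, with $w_i\in F(X)$ and $r_i\in R^{\pm1}$. The Dehn function of the presentation is $\delta(n)=\max\{\mathrm{Area}(w)\mid w \text{ represents } 1,\ |w|\leq n\}$. For non-decreasing $f,g\colon\mathbb{N}\to\mathbb{N}$ write $f\preccurlyeq g$ if there is a constant $C>0$ with $f(n)\leq C\,g(Cn+C)+Cn+C$ for all $n$, and $f\asymp g$ if $f\preccurlyeq g\preccurlyeq f$ (one may take $C$ to be an integer). A group has quadratic Dehn function if it is finitely presented and the Dehn function $\delta$ of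 each of its finite presentations satisfies $\delta(n)\asymp n^2$. Theorem. If $r\geq 4$ and $\left\lceil \frac{l}{2}\right\rceil\leq\frac{r}{4}$, then for every $m\geq 1$ and every $\phi$ as above the group $K_m^r(l)=\ker\phi$ has quadratic Dehn function. -/

import Mathlib

/-- The group element `w` is a product of `k` conjugates of elements of `R` and of their inverses,
where the conjugators are arbitrary elements of the group. -/
def IsProdOfConjugates {F : Type*} [Group F] (R : Set F) (w : F) (k : ℕ) : Prop :=
  ∃ c : List (F × F), c.length = k ∧ (∀ p ∈ c, p.2 ∈ R ∨ p.2⁻¹ ∈ R) ∧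
    w = (c.map fun p => p.1 * p.2 * p.1⁻¹).prod

/-- A word `w` in the letters `x` and `x⁻¹`, for `x` in `X` (the letter `(x, true)` stands for `x`
and `(x, false)` for `x⁻¹`; the word need not be reduced), that represents the trivial element of
the group `⟨X | R⟩`. -/
def IsNullHomotopic {X : Type*} (R : Set (FreeGroup X)) (w : List (X × Bool)) : Prop :=
  PresentedGroup.mk R (FreeGroup.mk w) = 1

/-- The area of a word that represents the trivial element of `⟨X | R⟩`: the least `k` such that
the word is equal in the free group on `X` to a product of `k` conjugates of relators and inverse
relators. (The minimum is over a nonempty set exactly when the word is null-homotopic; it is used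
only then.) -/
noncomputable def area {X : Type*} (R : Set (FreeGroup X)) (w : List (X × Bool)) : ℕ :=
  sInf {k : ℕ | IsProdOfConjugates R (FreeGroup.mk w) k}

/-- The Dehn function of the presentation `⟨X | R⟩`: the largest area of a null-homotopic word of
length at most `n`. (For finite `X` there are only finitely many words of length at most `n`, and
the empty word is one, so that this is the maximum of a finite nonempty set.) -/
noncomputable def dehnFunction {X : Type*} (R : Set (FreeGroup X)) (n : ℕ) : ℕ :=
  sSup {a : ℕ | ∃ w : List (X × Bool), w.length ≤ n ∧ IsNullHomotopic R w ∧ a = area R w}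

/-- The relation `f ≼ g` between non-decreasing functions: for some constant `C > 0`,
`f n ≤ C * g (C * n + C) + C * n + C` for all `n`. -/
def AsympLE (f g : ℕ → ℕ) : Prop :=
  ∃ C : ℕ, 0 < C ∧ ∀ n : ℕ, f n ≤ C * g (C * n + C) + C * n + C

/-- Asymptotic equivalence `f ≍ g`, that is, `f ≼ g` and `g ≼ f`. -/
def AsympEquiv (f g : ℕ → ℕ) : Prop :=
  AsympLE f g ∧ AsympLE g f

/-- The group `G` has quadratic Dehn function: it is finitely presented, and the Dehn function of
each of its finite presentations is asymptotically equivalent to `n ^ 2`. -/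
def HasQuadraticDehnFunction (G : Type*) [Group G] : Prop :=
  Group.IsFinitelyPresented G ∧
    ∀ (X : Type) [Finite X] (R : Set (FreeGroup X)), R.Finite →
      Nonempty (G ≃* PresentedGroup R) → AsympEquiv (dehnFunction R) (fun n => n ^ 2)

/-! Upper bound. The `r` factors are split into two parts, each with at least `l` and at least two
factors. Lifting the basis of `ℤ^l` to distinct factors of one part gives a section of `φ` supported
there (`sec`). An element of a factor in one part is corrected to an element of the kernel `K` by
the section in the other part (`twist`), and each element of `K` is a product of such corrected
elements, those of the first part preceding those of the second. This defines normal forms `ω`, and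
by repeated halving of words it suffices that the triangles `ω(g) ω(h) ω(gh)⁻¹` have quadratic area
(`exists_areaLE_of_triangles`).

Triangles are filled by computing in the group of families of words modulo families of quadratic
area (`quadNull`). Homomorphisms from free groups to `K` act on families of linear length
(`famMap`). Commutation and pointwise products of such homomorphisms survive in the quotient, since
commuting two words of length `n` costs about `n²` commutators of letters. In particular, on
elements of a factor that `φ` kills, the choice of the correcting section does not matter
(`famMap_twist_eq`). The triangle identity reduces to one fact: elements of the first part killed by
`φ` commute with such elements of the second (`half_commute_half`). On generators this is seen by
correcting with a section chosen for the given pair, which makes the elements commute in `K` itself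
(`gens_commute`).

Lower bound. `K` contains commuting elements `a`, `b` separated by two homomorphisms to `ℤ`. These
lift to a map from the free group to the Heisenberg group, under which relators become central and
bounded while `⁅aⁿ, bⁿ⁆` has central coordinate `n²` (`asympLE_dehnFunction`). -/

/-! ### Area with respect to a set of relators. -/

section Area

variable {F : Type*} [Group F]

/-- The element `w` is a product of at most `k` conjugates of elements of `R` and of their
inverses. -/
def AreaLE (R : Set F) (k : ℕ) (w : F) : Prop :=
  ∃ j ≤ k, IsProdOfConjugates R w j

namespace AreaLE

variable {R S : Set F} {k l : ℕ} {v w : F}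

theorem one (R : Set F) : AreaLE R 0 1 := ⟨0, le_rfl, [], by simp⟩

theorem of_mem (h : w ∈ R) : AreaLE R 1 w := ⟨1, le_rfl, [(1, w)], by simp [h]⟩

theorem mono (h : AreaLE R k w) (hkl : k ≤ l) : AreaLE R l w :=
  let ⟨j, hj, hw⟩ := h
  ⟨j, hj.trans hkl, hw⟩

theorem mono_set (h : AreaLE R k w) (hRS : R ⊆ S) : AreaLE S k w :=
  let ⟨j, hj, c, hc, hm, hw⟩ := h
  ⟨j, hj, c, hc, fun p hp => (hm p hp).imp (fun h => hRS h) (fun h => hRS h), hw⟩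

theorem mul (hv : AreaLE R k v) (hw : AreaLE R l w) : AreaLE R (k + l) (v * w) := by
  obtain ⟨i, hi, c, hc, hm, rfl⟩ := hv
  obtain ⟨j, hj, d, hd, hn, rfl⟩ := hw
  refine ⟨i + j, by omega, c ++ d, by simp [hc, hd], ?_, by simp⟩
  intro p hp
  rcases List.mem_append.1 hp with h | h
  exacts [hm p h, hn p h]

theorem conj (h : AreaLE R k w) (g : F) : AreaLE R k (g * w * g⁻¹) := by
  obtain ⟨i, hi, c, hc, hm, rfl⟩ := h
  refine ⟨i, hi, c.map (fun p => (g * p.1, p.2)), by simp [hc], ?_, ?_⟩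
  · intro p hp
    obtain ⟨q, hq, rfl⟩ := List.mem_map.1 hp
    exact hm q hq
  · clear hi hc hm
    induction c with
    | nil => simp
    | cons p c ih =>
      simp only [List.map_cons, List.prod_cons] at ih ⊢
      rw [← ih]
      group

theorem inv (h : AreaLE R k w) : AreaLE R k w⁻¹ := by
  obtain ⟨i, hi, c, hc, hm, rfl⟩ := h
  refine ⟨i, hi, (c.map (fun p => (p.1, p.2⁻¹))).reverse, by simp [hc], ?_, ?_⟩
  · intro p hp
    obtain ⟨q, hq, rfl⟩ := List.mem_map.1 (List.mem_reverse.1 hp)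
    simpa using (hm q hq).symm
  · rw [List.prod_inv_reverse]
    simp [List.map_reverse, Function.comp_def, mul_assoc]

theorem eq_one_of_hom {M : Type*} [Group M] (f : F →* M) (hf : ∀ r ∈ R, f r = 1)
    (h : AreaLE R k w) : f w = 1 := by
  obtain ⟨i, hi, c, hc, hm, rfl⟩ := h
  rw [map_list_prod]
  refine List.prod_eq_one ?_
  simp only [List.map_map, List.mem_map, Function.comp_apply, forall_exists_index, and_imp]
  rintro _ p hp rfl
  have : f p.2 = 1 := by
    rcases hm p hp with h | h
    · exact hf _ h
    · simpa using hf _ h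
  simp [this]

end AreaLE

theorem exists_areaLE_of_mem_normalClosure {R : Set F} {w : F}
    (h : w ∈ Subgroup.normalClosure R) : ∃ k, AreaLE R k w := by
  let N : Subgroup F :=
    { carrier := {w | ∃ k, AreaLE R k w}
      one_mem' := ⟨0, .one R⟩
      mul_mem' := fun ⟨k, hk⟩ ⟨l, hl⟩ => ⟨k + l, hk.mul hl⟩
      inv_mem' := fun ⟨k, hk⟩ => ⟨k, hk.inv⟩ }
  have : N.Normal := ⟨fun _ ⟨k, hk⟩ g => ⟨k, hk.conj g⟩⟩
  exact Subgroup.normalClosure_le_normal (N := N) (fun r hr => ⟨1, .of_mem hr⟩) h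

theorem AreaLE.mem_normalClosure {R : Set F} {k : ℕ} {w : F} (h : AreaLE R k w) :
    w ∈ Subgroup.normalClosure R := by
  rw [← QuotientGroup.eq_one_iff (N := Subgroup.normalClosure R)]
  exact h.eq_one_of_hom (QuotientGroup.mk' (Subgroup.normalClosure R)) fun r hr =>
    (QuotientGroup.eq_one_iff _).2 (Subgroup.subset_normalClosure hr)

theorem AreaLE.trans {R S : Set F} {c k : ℕ} {w : F} (h : AreaLE R k w)
    (hRS : ∀ r ∈ R, AreaLE S c r) : AreaLE S (c * k) w := by
  obtain ⟨i, hi, p, hc, hm, rfl⟩ := h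
  refine AreaLE.mono (k := c * i) ?_ (Nat.mul_le_mul_left c hi)
  subst hc
  clear hi
  induction p with
  | nil => simpa using AreaLE.one S
  | cons q p ih =>
    simp only [List.map_cons, List.prod_cons, List.length_cons]
    rw [Nat.mul_succ, add_comm]
    refine AreaLE.mul (AreaLE.conj ?_ _) (ih fun r hr => hm r (List.mem_cons_of_mem _ hr))
    rcases hm q List.mem_cons_self with h | h
    · exact hRS _ h
    · simpa using (hRS _ h).inv

/-- Changing one finite set of relators for another costs a constant factor, so an arbitrary finite
presentation can be treated with conveniently chosen relators. -/
theorem AreaLE.exists_of_finite {R S : Set F} (hR : R.Finite)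
    (hRS : R ⊆ Subgroup.normalClosure S) :
    ∃ c, ∀ k w, AreaLE R k w → AreaLE S (c * k) w := by
  have h : ∀ r ∈ R, ∃ c, AreaLE S c r := fun r hr =>
    exists_areaLE_of_mem_normalClosure (hRS hr)
  choose! c hc using h
  obtain ⟨b, hb⟩ := (hR.image c).bddAbove
  exact ⟨b, fun k w hw => hw.trans fun r hr => (hc r hr).mono (hb ⟨r, hr, rfl⟩)⟩

end Area

/-! ### Quadratic bounds for commutators and products of words. -/

section Words

open scoped commutatorElement

variable {F Y Z : Type*} [Group F]

theorem FreeGroup.mk_cons (p : Y × Bool) (L : List (Y × Bool)) :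
    FreeGroup.mk (p :: L) = FreeGroup.mk [p] * FreeGroup.mk L := by
  rw [FreeGroup.mul_mk]
  rfl

/-- `⁅xy, c⁆ = x⁅y, c⁆x⁻¹ · ⁅x, c⁆`, so each letter adds `n` to the area. -/
theorem areaLE_commutator_mk {R : Set F} (α : FreeGroup Y →* F) (c : F) {n : ℕ}
    (h : ∀ p, AreaLE R n ⁅α (FreeGroup.mk [p]), c⁆) (L : List (Y × Bool)) :
    AreaLE R (L.length * n) ⁅α (FreeGroup.mk L), c⁆ := by
  induction L with
  | nil => simpa [← FreeGroup.one_eq_mk] using AreaLE.one R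
  | cons p L ih =>
    have : ⁅α (FreeGroup.mk (p :: L)), c⁆ = α (FreeGroup.mk [p]) * ⁅α (FreeGroup.mk L), c⁆ *
        (α (FreeGroup.mk [p]))⁻¹ * ⁅α (FreeGroup.mk [p]), c⁆ := by
      rw [FreeGroup.mk_cons, map_mul]
      simp only [commutatorElement_def]
      group
    rw [this, List.length_cons, Nat.succ_mul]
    exact (ih.conj _).mul (h p)

/-- The commutators of the images of the letters under two homomorphisms of free groups. -/
def letterCommutators (α : FreeGroup Y →* F) (β : FreeGroup Z →* F) : Set F :=
  Set.range fun p : (Y × Bool) × (Z × Bool) =>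
    ⁅α (FreeGroup.mk [p.1]), β (FreeGroup.mk [p.2])⁆

theorem areaLE_commutator_mk_mk (α : FreeGroup Y →* F) (β : FreeGroup Z →* F)
    (L : List (Y × Bool)) (M : List (Z × Bool)) :
    AreaLE (letterCommutators α β) (L.length * M.length)
      ⁅α (FreeGroup.mk L), β (FreeGroup.mk M)⁆ := by
  refine areaLE_commutator_mk α _ (fun p => ?_) L
  rw [← commutatorElement_inv]
  refine AreaLE.inv ?_
  rw [← mul_one M.length]
  refine areaLE_commutator_mk β _ (fun q => ?_) M
  rw [← commutatorElement_inv]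
  exact (AreaLE.of_mem (R := letterCommutators α β) ⟨(p, q), rfl⟩).inv

/-- Prepending a letter `p` to `L` takes one relator for `γ p` and one passage of `β p` through `α
L`, at a cost of `|L|` commutators of letters; the total is quadratic. -/
theorem areaLE_mul_inv_mk {R : Set F} (α β γ : FreeGroup Y →* F)
    (hR : letterCommutators α β ⊆ R)
    (hR' : ∀ p : Y × Bool, γ (FreeGroup.mk [p]) *
      (α (FreeGroup.mk [p]) * β (FreeGroup.mk [p]))⁻¹ ∈ R) (L : List (Y × Bool)) :
    AreaLE R (L.length ^ 2) (γ (FreeGroup.mk L) *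
      (α (FreeGroup.mk L) * β (FreeGroup.mk L))⁻¹) := by
  induction L with
  | nil => simpa [← FreeGroup.one_eq_mk] using AreaLE.one R
  | cons p L ih =>
    have hp : β (FreeGroup.mk [(p.1, !p.2)]) = (β (FreeGroup.mk [p]))⁻¹ := by
      rw [← map_inv, FreeGroup.inv_mk]
      simp [FreeGroup.invRev]
    have h1 : AreaLE R L.length ⁅α (FreeGroup.mk L), (β (FreeGroup.mk [p]))⁻¹⁆ := by
      have := (areaLE_commutator_mk_mk α β L [(p.1, !p.2)]).mono_set hR
      rwa [hp, List.length_singleton, mul_one] at this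
    have := ((ih.conj (γ (FreeGroup.mk [p]))).mul (h1.conj (γ (FreeGroup.mk [p])))).mul
      (AreaLE.of_mem (hR' p))
    refine AreaLE.mono (k := L.length ^ 2 + L.length + 1) ?_ (by simp; nlinarith)
    convert this using 1
    rw [FreeGroup.mk_cons]
    simp only [map_mul, commutatorElement_def]
    group

end Words

/-! ### Coordinates on the free abelian group. -/

/-- The free abelian group of rank `l`, written multiplicatively. -/
abbrev FreeAb (l : ℕ) : Type := Multiplicative (Fin l → ℤ)

namespace FreeAb

variable {l : ℕ}

/-- The standard basis of the free abelian group. -/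
def basis (j : Fin l) : FreeAb l := Multiplicative.ofAdd (Pi.single j 1)

/-- The coordinates on the free abelian group. -/
def coord (j : Fin l) : FreeAb l →* Multiplicative ℤ :=
  AddMonoidHom.toMultiplicative (Pi.evalAddMonoidHom (fun _ => ℤ) j)

theorem eq_list_prod (v : FreeAb l) :
    v = ((List.finRange l).map fun j => basis j ^ (coord j v).toAdd).prod := by
  rw [← List.ofFn_eq_map, List.prod_ofFn]
  apply Multiplicative.toAdd.injective
  rw [toAdd_prod]
  funext i
  simp [basis, coord, Finset.sum_apply, Pi.single_apply]

end FreeAb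

/-! ### Families of words modulo quadratic area. -/

section Families

open scoped commutatorElement

variable {F K Θ Y Z : Type*} [Group F] [Group K]

/-- Families of words, indexed by `Θ`, that have area at most quadratic in the size of the index,
with respect to some finite set of relations of `K`. -/
def quadNull (π : F →* K) (sz : Θ → ℕ) : Subgroup (Θ → F) where
  carrier := {w | ∃ R : Set F, R.Finite ∧ (∀ r ∈ R, π r = 1) ∧
    ∃ C : ℕ, ∀ θ, AreaLE R (C * sz θ ^ 2) (w θ)}
  one_mem' := ⟨∅, Set.finite_empty, by simp, 0, fun θ => by simpa using AreaLE.one _⟩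
  mul_mem' := by
    rintro v w ⟨R, hR, hRπ, C, hC⟩ ⟨S, hS, hSπ, D, hD⟩
    refine ⟨R ∪ S, hR.union hS, fun r hr => hr.elim (hRπ r) (hSπ r), C + D, fun θ => ?_⟩
    rw [add_mul]
    exact ((hC θ).mono_set Set.subset_union_left).mul ((hD θ).mono_set Set.subset_union_right)
  inv_mem' := fun ⟨R, hR, hRπ, C, hC⟩ => ⟨R, hR, hRπ, C, fun θ => (hC θ).inv⟩

instance quadNull_normal (π : F →* K) (sz : Θ → ℕ) : (quadNull π sz).Normal :=
  ⟨fun _ ⟨R, hR, hRπ, C, hC⟩ g => ⟨R, hR, hRπ, C, fun θ => (hC θ).conj (g θ)⟩⟩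

/-- Families of elements of a free group whose length is at most linear in the size of the
index. -/
def linFam (Y : Type*) [DecidableEq Y] (sz : Θ → ℕ) : Subgroup (Θ → FreeGroup Y) where
  carrier := {u | ∃ C : ℕ, ∀ θ, (u θ).norm ≤ C * sz θ}
  one_mem' := ⟨0, fun θ => by simp⟩
  mul_mem' := by
    rintro u v ⟨C, hC⟩ ⟨D, hD⟩
    refine ⟨C + D, fun θ => (FreeGroup.norm_mul_le _ _).trans ?_⟩
    rw [add_mul]
    exact add_le_add (hC θ) (hD θ)
  inv_mem' := fun ⟨C, hC⟩ => ⟨C, fun θ => by simpa using hC θ⟩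

theorem exists_norm_map_le [Finite Y] [DecidableEq Y] [DecidableEq Z]
    (f : FreeGroup Y →* FreeGroup Z) : ∃ C : ℕ, ∀ u, (f u).norm ≤ C * u.norm := by
  obtain ⟨C, hC⟩ := (Set.finite_range fun y => (f (FreeGroup.of y)).norm).bddAbove
  have hC : ∀ y, (f (FreeGroup.of y)).norm ≤ C := fun y => hC ⟨y, rfl⟩
  have h1 : ∀ p : Y × Bool, (f (FreeGroup.mk [p])).norm ≤ C := by
    rintro ⟨y, _ | _⟩
    · have : FreeGroup.mk [(y, false)] = (FreeGroup.of y)⁻¹ := rfl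
      rw [this, map_inv, FreeGroup.norm_inv_eq]
      exact hC y
    · exact hC y
  have h2 : ∀ L : List (Y × Bool), (f (FreeGroup.mk L)).norm ≤ C * L.length := by
    intro L
    induction L with
    | nil => simp [← FreeGroup.one_eq_mk]
    | cons p L ih =>
      rw [FreeGroup.mk_cons, map_mul, List.length_cons, Nat.mul_succ, add_comm]
      exact (FreeGroup.norm_mul_le _ _).trans (add_le_add (h1 p) ih)
  refine ⟨C, fun u => ?_⟩
  have := h2 u.toWord
  rwa [FreeGroup.mk_toWord] at this

theorem linFam_map [Finite Y] [DecidableEq Y] [DecidableEq Z] {sz : Θ → ℕ}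
    (f : FreeGroup Y →* FreeGroup Z) {u : Θ → FreeGroup Y} (hu : u ∈ linFam Y sz) :
    (fun θ => f (u θ)) ∈ linFam Z sz := by
  obtain ⟨C, hC⟩ := hu
  obtain ⟨D, hD⟩ := exists_norm_map_le f
  refine ⟨D * C, fun θ => (hD _).trans ?_⟩
  rw [mul_assoc]
  exact Nat.mul_le_mul_left D (hC θ)

variable {π : F →* K} (hπ : Function.Surjective π)

/-- A lift to `F` of a homomorphism from a free group to a quotient of `F`. -/
noncomputable def liftHom (f : FreeGroup Y →* K) : FreeGroup Y →* F :=
  FreeGroup.lift fun y => Function.surjInv hπ (f (FreeGroup.of y))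

@[simp]
theorem map_liftHom (f : FreeGroup Y →* K) (u : FreeGroup Y) : π (liftHom hπ f u) = f u := by
  have : π.comp (liftHom hπ f) = f := by
    ext y
    simp [liftHom, Function.surjInv_eq hπ]
  exact DFunLike.congr_fun this u

/-- The homomorphism that a homomorphism from a free group to `K` induces on families, with values
in the group of families of words over `K` up to quadratic area. -/
noncomputable def famMap (sz : Θ → ℕ) (f : FreeGroup Y →* K) :
    (Θ → FreeGroup Y) →* (Θ → F) ⧸ quadNull π sz :=
  (QuotientGroup.mk' _).comp ((liftHom hπ f).compLeft Θ)

theorem areaLE_of_commute [Finite Y] [DecidableEq Y] [Finite Z] [DecidableEq Z] {sz : Θ → ℕ}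
    {α : FreeGroup Y →* F} {β : FreeGroup Z →* F}
    (h : ∀ x y, Commute (π (α x)) (π (β y))) {u : Θ → FreeGroup Y} {v : Θ → FreeGroup Z}
    (hu : u ∈ linFam Y sz) (hv : v ∈ linFam Z sz) :
    Commute ((fun θ => α (u θ) : Θ → F) : (Θ → F) ⧸ quadNull π sz)
      ((fun θ => β (v θ) : Θ → F) : (Θ → F) ⧸ quadNull π sz) := by
  rw [← commutatorElement_eq_one_iff_commute]
  refine (QuotientGroup.eq_one_iff (N := quadNull π sz)
    (⁅fun θ => α (u θ), fun θ => β (v θ)⁆ : Θ → F)).2 ?_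
  obtain ⟨C, hC⟩ := hu
  obtain ⟨D, hD⟩ := hv
  refine ⟨letterCommutators α β, Set.finite_range _, ?_, C * D, fun θ => ?_⟩
  · rintro _ ⟨p, rfl⟩
    simpa [map_commutatorElement, commutatorElement_eq_one_iff_commute] using h _ _
  · have := areaLE_commutator_mk_mk α β (u θ).toWord (v θ).toWord
    rw [FreeGroup.mk_toWord, FreeGroup.mk_toWord] at this
    refine AreaLE.mono this ((Nat.mul_le_mul (hC θ) (hD θ)).trans (le_of_eq ?_))
    ring

theorem areaLE_of_mul [Finite Y] [DecidableEq Y] {sz : Θ → ℕ}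
    {α β γ : FreeGroup Y →* F} (h : ∀ x y, Commute (π (α x)) (π (β y)))
    (hmul : ∀ x, π (γ x) = π (α x) * π (β x)) {u : Θ → FreeGroup Y} (hu : u ∈ linFam Y sz) :
    ((fun θ => γ (u θ) : Θ → F) : (Θ → F) ⧸ quadNull π sz) =
      ((fun θ => α (u θ) : Θ → F) : (Θ → F) ⧸ quadNull π sz) *
      ((fun θ => β (u θ) : Θ → F) : (Θ → F) ⧸ quadNull π sz) := by
  rw [← mul_inv_eq_one]
  refine (QuotientGroup.eq_one_iff (N := quadNull π sz)
    ((fun θ => γ (u θ) * (α (u θ) * β (u θ))⁻¹) : Θ → F)).2 ?_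
  obtain ⟨C, hC⟩ := hu
  refine ⟨letterCommutators α β ∪ Set.range fun p : Y × Bool => γ (FreeGroup.mk [p]) *
      (α (FreeGroup.mk [p]) * β (FreeGroup.mk [p]))⁻¹,
    (Set.finite_range _).union (Set.finite_range _), ?_, C ^ 2, fun θ => ?_⟩
  · rintro _ (⟨p, rfl⟩ | ⟨p, rfl⟩)
    · simpa [map_commutatorElement, commutatorElement_eq_one_iff_commute] using h _ _
    · simp only [map_mul, map_inv, hmul, mul_inv_cancel]
  · have := areaLE_mul_inv_mk (R := letterCommutators α β ∪ Set.range fun p : Y × Bool =>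
        γ (FreeGroup.mk [p]) * (α (FreeGroup.mk [p]) * β (FreeGroup.mk [p]))⁻¹) α β γ
      Set.subset_union_left (fun p => Set.mem_union_right _ ⟨p, rfl⟩) (u θ).toWord
    rw [FreeGroup.mk_toWord] at this
    refine AreaLE.mono this ((Nat.pow_le_pow_left (hC θ) 2).trans (le_of_eq ?_))
    ring

variable {sz : Θ → ℕ}

theorem famMap_commute [Finite Y] [DecidableEq Y] [Finite Z] [DecidableEq Z]
    {f : FreeGroup Y →* K} {g : FreeGroup Z →* K} (h : ∀ x y, Commute (f x) (g y))
    {u : Θ → FreeGroup Y} {v : Θ → FreeGroup Z}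
    (hu : u ∈ linFam Y sz) (hv : v ∈ linFam Z sz) :
    Commute (famMap hπ sz f u) (famMap hπ sz g v) :=
  areaLE_of_commute (α := liftHom hπ f) (β := liftHom hπ g) (by simpa using h) hu hv

theorem famMap_mul [Finite Y] [DecidableEq Y] {f g k : FreeGroup Y →* K}
    (h : ∀ x y, Commute (f x) (g y)) (hk : ∀ x, k x = f x * g x)
    {u : Θ → FreeGroup Y} (hu : u ∈ linFam Y sz) :
    famMap hπ sz k u = famMap hπ sz f u * famMap hπ sz g u :=
  areaLE_of_mul (α := liftHom hπ f) (β := liftHom hπ g) (γ := liftHom hπ k)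
    (by simpa using h) (by simpa using hk) hu

/-- Taking `β = 1` in `areaLE_of_mul` shows that all lifts of `f` agree on linear families, so the
arbitrary choice in `liftHom` is harmless. -/
theorem famMap_eq_of_lift [Finite Y] [DecidableEq Y] {f : FreeGroup Y →* K} {α : FreeGroup Y →* F}
    (h : ∀ x, π (α x) = f x) {u : Θ → FreeGroup Y} (hu : u ∈ linFam Y sz) :
    famMap hπ sz f u = ((fun θ => α (u θ) : Θ → F) : (Θ → F) ⧸ quadNull π sz) := by
  refine (areaLE_of_mul (α := α) (β := 1) (γ := liftHom hπ f) (by simp) (by simp [h]) hu).trans ?_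
  exact mul_one _

theorem famMap_comp [Finite Y] [DecidableEq Y] (f : FreeGroup Z →* K)
    (g : FreeGroup Y →* FreeGroup Z) {u : Θ → FreeGroup Y} (hu : u ∈ linFam Y sz) :
    famMap hπ sz (f.comp g) u = famMap hπ sz f (fun θ => g (u θ)) :=
  famMap_eq_of_lift hπ (α := (liftHom hπ f).comp g) (by simp) hu

theorem famMap_one [Finite Y] [DecidableEq Y] {u : Θ → FreeGroup Y} (hu : u ∈ linFam Y sz) :
    famMap hπ sz (1 : FreeGroup Y →* K) u = 1 :=
  famMap_eq_of_lift hπ (α := 1) (by simp) hu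

/-- A homomorphism that is a product of pairwise commuting homomorphisms induces the product of
the induced maps. -/
theorem famMap_list_prod [Finite Y] [DecidableEq Y] {ι : Type*} (f : ι → FreeGroup Y →* K)
    {L : List ι} (hL : L.Nodup) (h : ∀ i ∈ L, ∀ j ∈ L, i ≠ j → ∀ x y, Commute (f i x) (f j y))
    (k : FreeGroup Y →* K) (hk : ∀ x, k x = (L.map fun i => f i x).prod)
    {u : Θ → FreeGroup Y} (hu : u ∈ linFam Y sz) :
    famMap hπ sz k u = (L.map fun i => famMap hπ sz (f i) u).prod := by
  induction L generalizing k with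
  | nil =>
    have : k = 1 := by
      ext x
      simp [hk]
    rw [this, famMap_one hπ hu]
    rfl
  | cons i L ih =>
    have hi : ∀ j ∈ L, ∀ x y, Commute (f i x) (f j y) := fun j hj =>
      h i List.mem_cons_self j (List.mem_cons_of_mem _ hj)
        fun e => (List.nodup_cons.1 hL).1 (e ▸ hj)
    -- The product over the tail is not given as a homomorphism; it is recovered as `(f i)⁻¹ * k`,
    -- multiplicative because `f i` commutes with the tail.
    let k' : FreeGroup Y →* K := 
      { toFun := fun x => (f i x)⁻¹ * k x
        map_one' := by simp
        map_mul' := fun x y => by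
          have : Commute ((f i y)⁻¹) ((f i x)⁻¹ * k x) := by
            rw [hk, List.map_cons, List.prod_cons, inv_mul_cancel_left]
            refine Commute.list_prod_right _ _ fun z hz => ?_
            obtain ⟨j, hj, rfl⟩ := List.mem_map.1 hz
            exact (hi j hj _ _).inv_left
          rw [map_mul, map_mul, mul_inv_rev, mul_assoc, ← mul_assoc _ (k x), ← mul_assoc,
            this.eq, mul_assoc] }
    have hk' : ∀ x, k' x = (L.map fun i => f i x).prod := fun x => by
      change (f i x)⁻¹ * k x = _
      rw [hk, List.map_cons, List.prod_cons, inv_mul_cancel_left]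
    rw [famMap_mul hπ (f := f i) (g := k') _ _ hu, List.map_cons, List.prod_cons,
      ih (List.nodup_cons.1 hL).2 (fun i hi j hj => h i (List.mem_cons_of_mem _ hi) j
        (List.mem_cons_of_mem _ hj)) k' hk']
    · intro x y
      rw [hk']
      refine Commute.list_prod_right _ _ fun z hz => ?_
      obtain ⟨j, hj, rfl⟩ := List.mem_map.1 hz
      exact hi j hj _ _
    · exact fun x => (mul_inv_cancel_left _ _).symm

/-- A homomorphism that factors through a free abelian group kills, up to quadratic area, linear
families in the kernel. -/
theorem famMap_eq_one_of_abelian [Finite Y] [DecidableEq Y] {l : ℕ}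
    (φ : FreeGroup Y →* FreeAb l) (κ : FreeAb l →* K)
    {u : Θ → FreeGroup Y} (hu : u ∈ linFam Y sz) (hφ : ∀ θ, φ (u θ) = 1) :
    famMap hπ sz (κ.comp φ) u = 1 := by
  let χ : Fin l → FreeGroup Y →* Multiplicative ℤ := fun j =>
    (FreeAb.coord j).comp φ
  let k : Fin l → K := fun j => κ (FreeAb.basis j)
  have hk : ∀ x, κ.comp φ x =
      ((List.finRange l).map fun j => ((zpowersHom K (k j)).comp (χ j)) x).prod := by
    intro x
    rw [MonoidHom.comp_apply, FreeAb.eq_list_prod (φ x), map_list_prod]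
    simp [χ, k, Function.comp_def, zpowersHom_apply]
  rw [famMap_list_prod hπ _ (List.nodup_finRange l) _ _ hk hu]
  · refine List.prod_eq_one ?_
    simp only [List.mem_map]
    rintro _ ⟨j, -, rfl⟩
    -- The `j`-th factor lifts to `F` through the coordinate `χ j`, and this lift is literally
    -- trivial on `u`.
    rw [famMap_eq_of_lift hπ (α := (zpowersHom F (Function.surjInv hπ (k j))).comp (χ j)) _ hu]
    · refine (QuotientGroup.eq_one_iff _).2 ?_
      convert (quadNull π sz).one_mem using 2 with θ
      simp [χ, hφ]
    · intro x
      simp [zpowersHom_apply, Function.surjInv_eq hπ]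
  · intro i _ j _ _ x y
    simp only [MonoidHom.comp_apply, zpowersHom_apply]
    exact ((Commute.all _ _).map κ).zpow_zpow _ _

end Families

/-! ### From triangles to arbitrary words. -/

/-- If the triangles of a normal form have quadratic area, then so do all words that represent the
trivial element. -/
theorem exists_areaLE_of_triangles {K X : Type*} [Group K] [Finite X] [DecidableEq X]
    (π : FreeGroup X →* K) (ω : K → FreeGroup X) (hω : ∀ g, π (ω g) = g)
    (h : (fun p : FreeGroup X × FreeGroup X => ω (π p.1) * ω (π p.2) * (ω (π (p.1 * p.2)))⁻¹) ∈
      quadNull π (fun p : FreeGroup X × FreeGroup X => p.1.norm + p.2.norm)) :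
    ∃ R : Set (FreeGroup X), R.Finite ∧ (∀ r ∈ R, π r = 1) ∧
      ∃ C : ℕ, ∀ w, π w = 1 → AreaLE R (C * w.norm ^ 2) w := by
  obtain ⟨S, hS, hSπ, C, hC⟩ := h
  set T : Set (FreeGroup X) := Set.range fun p : X × Bool =>
    FreeGroup.mk [p] * (ω (π (FreeGroup.mk [p])))⁻¹ with hT
  -- The triangle on `(1, 1)` equals `ω 1` and has size 0, hence area 0.
  have h1 : AreaLE (S ∪ T) 0 (ω 1) := by
    simpa using (hC (1, 1)).mono_set Set.subset_union_left
  -- Halving gives `A(n) ≤ A(p) + A(q) + C n²` with `p = n / 2` and `q = n - p`. As `p ≤ q ≤ 2p`,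
  -- one has `n² ≤ 5pq`, so the cross term `2(3C + 1)pq` absorbs `C n²`; the `+ 1` pays for words of
  -- one letter.
  have key : ∀ n, ∀ L : List (X × Bool), L.length = n →
      AreaLE (S ∪ T) ((3 * C + 1) * n ^ 2) (FreeGroup.mk L * (ω (π (FreeGroup.mk L)))⁻¹) := by
    intro n
    induction n using Nat.strong_induction_on with
    | _ n ih =>
      intro L hL
      rcases lt_or_ge n 2 with hn | hn
      · rcases L with _ | ⟨p, _ | ⟨q, L⟩⟩
        · subst hL
          rw [← FreeGroup.one_eq_mk, map_one, one_mul]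
          simpa using h1.inv
        · subst hL
          exact (AreaLE.of_mem (R := S ∪ T) (Set.mem_union_right _ ⟨p, rfl⟩)).mono (by simp)
        · simp at hL
          omega
      · have hu := ih (n / 2) (by omega) (L.take (n / 2)) (by simp; omega)
        have hv := ih (n - n / 2) (by omega) (L.drop (n / 2)) (by simp; omega)
        have ht := (hC (FreeGroup.mk (L.take (n / 2)),
          FreeGroup.mk (L.drop (n / 2)))).mono_set (Set.subset_union_left (t := T))
        have huv : FreeGroup.mk L =
            FreeGroup.mk (L.take (n / 2)) * FreeGroup.mk (L.drop (n / 2)) := by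
          rw [FreeGroup.mul_mk, List.take_append_drop]
        have hnu : (FreeGroup.mk (L.take (n / 2))).norm ≤ n / 2 :=
          FreeGroup.norm_mk_le.trans (by simp)
        have hnv : (FreeGroup.mk (L.drop (n / 2))).norm ≤ n - n / 2 :=
          FreeGroup.norm_mk_le.trans (by simp; omega)
        rw [huv]
        generalize FreeGroup.mk (L.take (n / 2)) = u at *
        generalize FreeGroup.mk (L.drop (n / 2)) = v at *
        have := (hu.mul (hv.conj (ω (π u)))).mul ht
        convert AreaLE.mono (l := (3 * C + 1) * n ^ 2) this ?_ using 1
        · group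
        · have hsz : u.norm + v.norm ≤ n / 2 + (n - n / 2) := add_le_add hnu hnv
          have hp : n / 2 ≤ n - n / 2 := by omega
          have hq : n - n / 2 ≤ 2 * (n / 2) := by omega
          have hpq : n = n / 2 + (n - n / 2) := by omega
          generalize n - n / 2 = q at *
          generalize n / 2 = p at *
          subst hpq
          have h5 : (p + q) ^ 2 ≤ 5 * (p * q) := by nlinarith
          have := Nat.mul_le_mul_left C (Nat.pow_le_pow_left hsz 2)
          simp only at this ⊢
          nlinarith [Nat.mul_le_mul_left C h5]
  refine ⟨S ∪ T, hS.union (Set.finite_range _), ?_, 3 * C + 1, fun w hw => ?_⟩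
  · rintro r (hr | ⟨p, rfl⟩)
    · exact hSπ r hr
    · simp [hω]
  · have h2 := (key _ w.toWord rfl).mul h1
    rw [FreeGroup.mk_toWord, hw, inv_mul_cancel_right] at h2
    exact h2

/-! ### The Heisenberg group as a detector of area. -/

/-- The integral Heisenberg group. -/
@[ext]
structure Heis where
  a : ℤ
  b : ℤ
  c : ℤ

namespace Heis

instance : Mul Heis := ⟨fun x y => ⟨x.a + y.a, x.b + y.b, x.c + y.c + x.a * y.b⟩⟩
instance : One Heis := ⟨⟨0, 0, 0⟩⟩
instance : Inv Heis := ⟨fun x => ⟨-x.a, -x.b, -x.c + x.a * x.b⟩⟩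

@[simp] theorem mul_a (x y : Heis) : (x * y).a = x.a + y.a := rfl
@[simp] theorem mul_b (x y : Heis) : (x * y).b = x.b + y.b := rfl
@[simp] theorem mul_c (x y : Heis) : (x * y).c = x.c + y.c + x.a * y.b := rfl
@[simp] theorem one_a : (1 : Heis).a = 0 := rfl
@[simp] theorem one_b : (1 : Heis).b = 0 := rfl
@[simp] theorem one_c : (1 : Heis).c = 0 := rfl
@[simp] theorem inv_a (x : Heis) : (x⁻¹).a = -x.a := rfl
@[simp] theorem inv_b (x : Heis) : (x⁻¹).b = -x.b := rfl
@[simp] theorem inv_c (x : Heis) : (x⁻¹).c = -x.c + x.a * x.b := rfl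

instance : Group Heis :=
  Group.ofLeftAxioms (fun x y z => by ext <;> simp <;> ring) (fun x => by ext <;> simp)
    (fun x => by ext <;> simp)

/-- The first coordinate of the Heisenberg group, as a homomorphism to `ℤ`. -/
def fst : Heis →* Multiplicative ℤ where
  toFun x := Multiplicative.ofAdd x.a
  map_one' := rfl
  map_mul' _ _ := rfl

/-- The second coordinate of the Heisenberg group, as a homomorphism to `ℤ`. -/
def snd : Heis →* Multiplicative ℤ where
  toFun x := Multiplicative.ofAdd x.b
  map_one' := rfl
  map_mul' _ _ := rfl

/-- Elements with `a = b = 0` are central and `c` is additive on them, so conjugation is invisible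
and each relator contributes at most `M`. -/
theorem abs_c_le {F : Type*} [Group F] (Λ : F →* Heis) {R : Set F} {M : ℕ}
    (hR : ∀ r ∈ R, (Λ r).a = 0 ∧ (Λ r).b = 0 ∧ |(Λ r).c| ≤ M) {k : ℕ} {w : F}
    (h : IsProdOfConjugates R w k) :
    (Λ w).a = 0 ∧ (Λ w).b = 0 ∧ |(Λ w).c| ≤ M * k := by
  obtain ⟨c, rfl, hc, rfl⟩ := h
  induction c with
  | nil => simp
  | cons p c ih =>
    obtain ⟨h1, h2, h3⟩ := ih fun q hq => hc q (List.mem_cons_of_mem _ hq)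
    have hp : (Λ p.2).a = 0 ∧ (Λ p.2).b = 0 ∧ |(Λ p.2).c| ≤ M := by
      rcases hc p List.mem_cons_self with h | h
      · exact hR _ h
      · obtain ⟨h1, h2, h3⟩ := hR _ h
        simp only [map_inv, inv_a, inv_b, inv_c, neg_eq_zero] at h1 h2 h3
        refine ⟨h1, h2, ?_⟩
        simpa [h1] using h3
    obtain ⟨h4, h5, h6⟩ := hp
    simp only [List.map_cons, List.prod_cons, map_mul, map_inv, mul_a, mul_b, mul_c, inv_a, inv_b,
      inv_c, List.length_cons, Nat.cast_add, Nat.cast_one, h1, h2, h4, h5]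
    refine ⟨by ring, by ring, ?_⟩
    calc _ = |(Λ p.2).c + (Λ (c.map fun p => p.1 * p.2 * p.1⁻¹).prod).c| := by congr 1; ring
      _ ≤ _ := abs_add_le _ _
      _ ≤ M + M * c.length := add_le_add h6 h3
      _ = _ := by ring

end Heis

/-! ### Comparing Dehn functions with `n ^ 2`. -/

section Dehn

variable {X : Type*} {R : Set (FreeGroup X)}

theorem isNullHomotopic_iff {w : List (X × Bool)} :
    IsNullHomotopic R w ↔ FreeGroup.mk w ∈ Subgroup.normalClosure R :=
  PresentedGroup.mk_eq_one_iff

theorem area_le {w : List (X × Bool)} {k : ℕ} (h : AreaLE R k (FreeGroup.mk w)) : area R w ≤ k :=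
  let ⟨_, hj, hw⟩ := h
  (Nat.sInf_le hw).trans hj

theorem isProdOfConjugates_area {w : List (X × Bool)} (h : IsNullHomotopic R w) :
    IsProdOfConjugates R (FreeGroup.mk w) (area R w) := by
  obtain ⟨k, j, -, hj⟩ := exists_areaLE_of_mem_normalClosure (isNullHomotopic_iff.1 h)
  exact Nat.sInf_mem (s := {k | IsProdOfConjugates R (FreeGroup.mk w) k}) ⟨j, hj⟩

theorem area_le_dehnFunction [Finite X] {w : List (X × Bool)} (h : IsNullHomotopic R w) {n : ℕ}
    (hn : w.length ≤ n) : area R w ≤ dehnFunction R n := by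
  refine le_csSup ?_ ⟨w, hn, h, rfl⟩
  refine ((List.finite_length_le (X × Bool) n).image (area R)).bddAbove.mono ?_
  rintro _ ⟨v, hv, -, rfl⟩
  exact ⟨v, hv, rfl⟩

theorem FreeGroup.norm_pow_le [DecidableEq X] (u : FreeGroup X) (n : ℕ) : (u ^ n).norm ≤ n * u.norm := by
  induction n with
  | zero => simp
  | succ n ih =>
    rw [pow_succ, Nat.succ_mul]
    exact (FreeGroup.norm_mul_le _ _).trans (Nat.add_le_add_right ih _)

/-- The lift `Λ` of `(f, g)` sends relators to central elements with bounded `c`, while the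
commutator of `n`-th powers of lifts of `a` and `b`, of length linear in `n`, has `c = n²`. -/
theorem asympLE_dehnFunction [Finite X] (hR : R.Finite) {K : Type*} [Group K]
    (e : K ≃* PresentedGroup R) (f g : K →* Multiplicative ℤ) {a b : K} (hab : Commute a b)
    (hfa : f a = Multiplicative.ofAdd 1) (hga : g a = 1) (hfb : f b = 1)
    (hgb : g b = Multiplicative.ofAdd 1) :
    AsympLE (fun n => n ^ 2) (dehnFunction R) := by
  classical
  set π : FreeGroup X →* K := (e.symm : PresentedGroup R →* K).comp (PresentedGroup.mk R) with hπ
  have hsurj : Function.Surjective π :=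
    e.symm.surjective.comp (PresentedGroup.mk_surjective R)
  have hker : ∀ w, π w = 1 ↔ PresentedGroup.mk R w = 1 := fun w => by simp [hπ]
  obtain ⟨a', rfl⟩ := hsurj a
  obtain ⟨b', rfl⟩ := hsurj b
  let Λ : FreeGroup X →* Heis := FreeGroup.lift fun x =>
    ⟨(f (π (FreeGroup.of x))).toAdd, (g (π (FreeGroup.of x))).toAdd, 0⟩
  have hΛa : ∀ w, (Λ w).a = (f (π w)).toAdd := fun w => by
    have : Heis.fst.comp Λ = f.comp π := by
      ext x
      simp [Λ, Heis.fst]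
    exact congrArg Multiplicative.toAdd (DFunLike.congr_fun this w)
  have hΛb : ∀ w, (Λ w).b = (g (π w)).toAdd := fun w => by
    have : Heis.snd.comp Λ = g.comp π := by
      ext x
      simp [Λ, Heis.snd]
    exact congrArg Multiplicative.toAdd (DFunLike.congr_fun this w)
  obtain ⟨M, hM⟩ := (hR.image fun r => (Λ r).c.natAbs).bddAbove
  have hRM : ∀ r ∈ R, (Λ r).a = 0 ∧ (Λ r).b = 0 ∧ |(Λ r).c| ≤ M := fun r hr => by
    have h1 : π r = 1 := (hker r).2 (PresentedGroup.one_of_mem hr)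
    refine ⟨by simp [hΛa, h1], by simp [hΛb, h1], ?_⟩
    rw [Int.abs_eq_natAbs]
    exact_mod_cast hM ⟨r, hr, rfl⟩
  set D := 2 * (a'.norm + b'.norm) with hD
  -- `M` bounds the central coordinates of the relators, and `D * n` bounds the length of the
  -- commutator word.
  refine ⟨M + D + 1, by omega, fun n => ?_⟩
  set w : FreeGroup X := a' ^ n * b' ^ n * (a' ^ n)⁻¹ * (b' ^ n)⁻¹ with hw
  have hπw : π w = 1 := by
    have := (hab.pow_pow n n).eq
    simp only [hw, map_mul, map_inv, map_pow, this]
    group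
  have hnull : IsNullHomotopic R w.toWord := by
    rw [IsNullHomotopic, FreeGroup.mk_toWord, ← hker, hπw]
  have hlen : w.toWord.length ≤ (M + D + 1) * n + (M + D + 1) := by
    have h1 := FreeGroup.norm_pow_le a' n
    have h2 := FreeGroup.norm_pow_le b' n
    have h3 : w.norm ≤ (a' ^ n).norm + (b' ^ n).norm + (a' ^ n).norm + (b' ^ n).norm := by
      refine (FreeGroup.norm_mul_le _ _).trans (add_le_add ((FreeGroup.norm_mul_le _ _).trans
        (add_le_add (FreeGroup.norm_mul_le _ _) ?_)) ?_) <;> rw [FreeGroup.norm_inv_eq]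
    change w.norm ≤ _
    rw [hD]
    nlinarith
  have h1 := Heis.abs_c_le Λ hRM (isProdOfConjugates_area hnull)
  have h2 : (Λ w).c = n ^ 2 := by
    have h3 : (Λ (a' ^ n)).a = n := by rw [hΛa]; simp [hfa]
    have h4 : (Λ (a' ^ n)).b = 0 := by rw [hΛb]; simp [hga]
    have h5 : (Λ (b' ^ n)).a = 0 := by rw [hΛa]; simp [hfb]
    have h6 : (Λ (b' ^ n)).b = n := by rw [hΛb]; simp [hgb]
    simp only [hw, map_mul Λ, map_inv Λ, Heis.mul_c, Heis.inv_c, Heis.mul_a, Heis.inv_a,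
      Heis.inv_b, h3, h4, h5, h6]
    ring
  rw [FreeGroup.mk_toWord, h2] at h1
  have h3 : n ^ 2 ≤ M * area R w.toWord := by
    have := (le_abs_self _).trans h1.2.2
    exact_mod_cast this
  have h4 := area_le_dehnFunction hnull hlen
  have h5 := h3.trans (Nat.mul_le_mul_left M h4)
  simp only
  nlinarith

theorem dehnFunction_asympLE [Finite X] [DecidableEq X] {S : Set (FreeGroup X)}
    (hS : S.Finite) (hSR : S ⊆ Subgroup.normalClosure R) {C : ℕ}
    (h : ∀ w ∈ Subgroup.normalClosure R, AreaLE S (C * w.norm ^ 2) w) :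
    AsympLE (dehnFunction R) (fun n => n ^ 2) := by
  obtain ⟨c, hc⟩ := AreaLE.exists_of_finite hS hSR
  refine ⟨c * C + 1, by omega, fun n => ?_⟩
  have h1 : dehnFunction R n ≤ c * (C * n ^ 2) := by
    refine csSup_le' ?_
    rintro _ ⟨w, hw, hnull, rfl⟩
    refine area_le ((hc _ _ (h _ (isNullHomotopic_iff.1 hnull))).mono ?_)
    gcongr
    exact FreeGroup.norm_mk_le.trans hw
  have h2 : n ≤ (c * C + 1) * n + (c * C + 1) :=
    (Nat.le_mul_of_pos_left n (Nat.succ_pos _)).trans (Nat.le_add_right _ _)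
  have h3 := Nat.mul_le_mul_left (c * C) (Nat.pow_le_pow_left h2 2)
  simp only
  nlinarith

end Dehn

/-- A criterion for a finitely generated group to have quadratic Dehn function. -/
theorem hasQuadraticDehnFunction_of_areaLE {K : Type*} [Group K]
    {n : ℕ} {p : FreeGroup (Fin n) →* K} (hp : Function.Surjective p)
    (h : ∀ (X : Type) [Finite X] [DecidableEq X] (π : FreeGroup X →* K), Function.Surjective π →
      ∃ R : Set (FreeGroup X), R.Finite ∧ (∀ r ∈ R, π r = 1) ∧
        ∃ C : ℕ, ∀ w, π w = 1 → AreaLE R (C * w.norm ^ 2) w)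
    (f g : K →* Multiplicative ℤ) {a b : K} (hab : Commute a b)
    (hfa : f a = Multiplicative.ofAdd 1) (hga : g a = 1) (hfb : f b = 1)
    (hgb : g b = Multiplicative.ofAdd 1) : HasQuadraticDehnFunction K := by
  classical
  refine ⟨⟨n, p, hp, ?_⟩, fun X _ R hR ⟨e⟩ => ⟨?_, asympLE_dehnFunction hR e f g hab hfa hga hfb hgb⟩⟩
  · obtain ⟨R, hR, hRp, C, hC⟩ := h (Fin n) p hp
    exact ⟨R, hR, le_antisymm (Subgroup.normalClosure_le_normal hRp)
      fun w hw => (hC w hw).mem_normalClosure⟩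
  · obtain ⟨S, hS, hSπ, C, hC⟩ := h X ((e.symm : PresentedGroup R →* K).comp (PresentedGroup.mk R))
      (e.symm.surjective.comp (PresentedGroup.mk_surjective R))
    have hker : ∀ w, (e.symm : PresentedGroup R →* K).comp (PresentedGroup.mk R) w = 1 ↔
        w ∈ Subgroup.normalClosure R := fun w => by
      rw [← PresentedGroup.mk_eq_one_iff]
      simp
    exact dehnFunction_asympLE hS (fun r hr => (hker r).1 (hSπ r hr))
      fun w hw => hC w ((hker w).2 hw)

/-! ### Embeddings of the factors corrected by a section. -/

section Twist

variable {ι Y : Type*} [DecidableEq ι] {l : ℕ}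

theorem commute_mulSingle {G : Type*} [Group G] {i : ι} {u : G} {p : ι → G}
    (h : Commute u (p i)) : Commute (Pi.mulSingle i u) p := by
  funext s
  by_cases hs : s = i
  · subst hs
    simpa using h.eq
  · simp [Pi.mulSingle_eq_of_ne hs]

/-- The restriction of a homomorphism on a direct product to one of the factors. -/
def factor (φ : (ι → FreeGroup Y) →* FreeAb l) (i : ι) : FreeGroup Y →* FreeAb l :=
  φ.comp (MonoidHom.mulSingle (fun _ => FreeGroup Y) i)

variable (φ : (ι → FreeGroup Y) →* FreeAb l)

/-- For a section `σ` of `φ`, the homomorphism that embeds a free group as the factor `i`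
of the direct product, and corrects the result by `σ` to obtain an element of the kernel. -/
noncomputable def twist {σ : FreeAb l →* (ι → FreeGroup Y)} (hσ : ∀ v, φ (σ v) = v) (i : ι) :
    FreeGroup Y →* φ.ker :=
  FreeGroup.lift fun y => ⟨Pi.mulSingle i (FreeGroup.of y) *
    (σ (factor φ i (FreeGroup.of y)))⁻¹, by simp [MonoidHom.mem_ker, hσ, factor]⟩

variable {φ} {σ σ' : FreeAb l →* (ι → FreeGroup Y)} (hσ : ∀ v, φ (σ v) = v)
  (hσ' : ∀ v, φ (σ' v) = v) {i k : ι}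

/-- `twist` fixes only the images of generators. The closed formula is multiplicative because `σ` is
trivial in the factor `i` and hence commutes with that factor. -/
theorem coe_twist (hi : ∀ v, σ v i = 1) (u : FreeGroup Y) :
    (twist φ hσ i u : ι → FreeGroup Y) = Pi.mulSingle i u * (σ (factor φ i u))⁻¹ := by
  let f : FreeGroup Y →* (ι → FreeGroup Y) :=
    { toFun := fun u => Pi.mulSingle i u * (σ (factor φ i u))⁻¹
      map_one' := by simp
      map_mul' := fun u v => by
        have h1 : Commute (Pi.mulSingle i v) (σ (factor φ i u))⁻¹ :=
          commute_mulSingle (by simp [hi])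
        have h2 : Commute (σ (factor φ i u))⁻¹ (σ (factor φ i v))⁻¹ :=
          ((Commute.all _ _).map σ).inv_inv
        rw [Pi.mulSingle_mul, map_mul, map_mul, mul_inv_rev, ← h2.eq, mul_assoc, ← mul_assoc _ _
          (σ (factor φ i v))⁻¹, h1.eq]
        simp only [mul_assoc] }
  have : φ.ker.subtype.comp (twist φ hσ i) = f := by
    ext1 y
    simp [twist, f]
  exact DFunLike.congr_fun this u

theorem twist_commute (hik : i ≠ k) (hi : ∀ v, σ v i = 1) (hk : ∀ v, σ v k = 1)
    (hi' : ∀ v, σ' v i = 1) (hk' : ∀ v, σ' v k = 1) (h : ∀ v w, Commute (σ v) (σ' w))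
    (x y : FreeGroup Y) : Commute (twist φ hσ i x) (twist φ hσ' k y) := by
  apply Subtype.ext
  change _ * _ = _ * _
  rw [coe_twist hσ hi, coe_twist hσ' hk']
  refine Commute.mul_left (Commute.mul_right ?_ ?_) (Commute.mul_right ?_ ?_)
  · exact commute_mulSingle (by simp [Pi.mulSingle_eq_of_ne hik])
  · exact commute_mulSingle (by simp [hi'])
  · exact (commute_mulSingle (by simp [hk])).symm
  · exact (h _ _).inv_inv

/-- The homomorphism to the kernel of `φ` given by the quotient of two sections that commute. -/
def sectionDiff (h : ∀ v w, Commute (σ v) (σ' w)) : FreeAb l →* φ.ker where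
  toFun v := ⟨σ v * (σ' v)⁻¹, by simp [MonoidHom.mem_ker, hσ, hσ']⟩
  map_one' := by simp
  map_mul' v w := by
    apply Subtype.ext
    change σ (v * w) * (σ' (v * w))⁻¹ = σ v * (σ' v)⁻¹ * (σ w * (σ' w)⁻¹)
    have h1 : Commute (σ' v) (σ' w) := (Commute.all _ _).map σ'
    rw [map_mul, map_mul, h1.eq, mul_inv_rev, mul_assoc, ← mul_assoc (σ w), mul_assoc (σ v),
      ← mul_assoc _ (σ w), ((h w v).inv_right).eq, mul_assoc]

theorem twist_mul_sectionDiff (h : ∀ v w, Commute (σ v) (σ' w)) (hi : ∀ v, σ v i = 1)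
    (hi' : ∀ v, σ' v i = 1) (x : FreeGroup Y) :
    twist φ hσ' i x = twist φ hσ i x * sectionDiff hσ hσ' h (factor φ i x) := by
  apply Subtype.ext
  change _ = _ * (_ * _)
  rw [coe_twist hσ hi, coe_twist hσ' hi']
  group

variable {F Θ : Type*} [Group F] {π : F →* φ.ker} (hπ : Function.Surjective π) {sz : Θ → ℕ}
  [Finite Y] [DecidableEq Y]

/-- Up to quadratic area, the corrected embedding does not depend on the section, on linear families
in the kernel. -/
theorem famMap_twist_eq (h : ∀ v w, Commute (σ v) (σ' w)) (hi : ∀ v, σ v i = 1)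
    (hi' : ∀ v, σ' v i = 1) {u : Θ → FreeGroup Y} (hu : u ∈ linFam Y sz)
    (hφ : ∀ θ, factor φ i (u θ) = 1) :
    famMap hπ sz (twist φ hσ i) u = famMap hπ sz (twist φ hσ' i) u := by
  -- The two embeddings differ by a homomorphism that factors through `FreeAb l`, which is trivial
  -- on families killed by `factor φ i`.
  rw [famMap_mul hπ (f := twist φ hσ i)
    (g := (sectionDiff hσ hσ' h).comp (factor φ i)) (k := twist φ hσ' i) ?_
    (twist_mul_sectionDiff hσ hσ' h hi hi') hu,
    famMap_eq_one_of_abelian hπ _ _ hu hφ, mul_one]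
  intro x y
  apply Subtype.ext
  change Commute (twist φ hσ i x : ι → FreeGroup Y) (σ (factor φ i y) * (σ' (factor φ i y))⁻¹)
  rw [coe_twist hσ hi]
  refine Commute.mul_left (Commute.mul_right ?_ ?_) (Commute.mul_right ?_ ?_)
  · exact commute_mulSingle (by simp [hi])
  · exact commute_mulSingle (by simp [hi'])
  · exact ((Commute.all _ _).map σ).inv_left
  · exact (h _ _).inv_inv

end Twist

/-! ### Sections that lift the basis to distinct factors, and changes of section. -/

theorem update_injective {ι : Type*} {l : ℕ} {τ : Fin l → ι} {s : ι} (hτ : Function.Injective τ) (j : Fin l)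
    (h : ∀ j', j' ≠ j → τ j' ≠ s) : Function.Injective (Function.update τ j s) := by
  intro a b hab
  by_cases ha : a = j <;> by_cases hb : b = j
  · rw [ha, hb]
  · subst ha
    rw [Function.update_self, Function.update_of_ne hb] at hab
    exact absurd hab.symm (h b hb)
  · subst hb
    rw [Function.update_self, Function.update_of_ne ha] at hab
    exact absurd hab (h a ha)
  · rw [Function.update_of_ne ha, Function.update_of_ne hb] at hab
    exact hτ hab

section Sections

variable {ι Y : Type*} [DecidableEq ι] {l : ℕ} (y : ι → Fin l → FreeGroup Y)

open Classical in
/-- The homomorphism from the free abelian group to the direct product that sends the `j`-th basis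
element to `y (τ j) j` in the factor `τ j`. -/
noncomputable def sec (τ : Fin l → ι) : FreeAb l →* (ι → FreeGroup Y) :=
  MonoidHom.pi fun s =>
    if h : ∃ j, τ j = s then (zpowersHom _ (y s h.choose)).comp (FreeAb.coord h.choose) else 1

variable {y} {τ τ' : Fin l → ι}

theorem sec_apply (hτ : Function.Injective τ) (v : FreeAb l) (j : Fin l) :
    sec y τ v (τ j) = y (τ j) j ^ (FreeAb.coord j v).toAdd := by
  have h : ∃ j', τ j' = τ j := ⟨j, rfl⟩
  have h2 : h.choose = j := hτ h.choose_spec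
  simp only [sec, MonoidHom.pi_apply, dif_pos h, MonoidHom.comp_apply, zpowersHom_apply]
  rw [h2]

theorem sec_apply_of_ne (v : FreeAb l) {s : ι} (h : ∀ j, τ j ≠ s) : sec y τ v s = 1 := by
  have h : ¬ ∃ j, τ j = s := fun ⟨j, hj⟩ => h j hj
  simp only [sec, MonoidHom.pi_apply, dif_neg h, MonoidHom.one_apply]

theorem map_sec {φ : (ι → FreeGroup Y) →* FreeAb l}
    (hy : ∀ i j, factor φ i (y i j) = FreeAb.basis j) (hτ : Function.Injective τ) (v : FreeAb l) :
    φ (sec y τ v) = v := by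
  have h1 : ∀ j, sec y τ (FreeAb.basis j) = Pi.mulSingle (τ j) (y (τ j) j) := by
    intro j
    funext s
    by_cases hs : ∃ j', τ j' = s
    · obtain ⟨j', rfl⟩ := hs
      rw [sec_apply hτ]
      by_cases hj : j' = j
      · subst hj
        simp [FreeAb.coord, FreeAb.basis]
      · rw [Pi.mulSingle_eq_of_ne (hτ.ne hj)]
        simp [FreeAb.coord, FreeAb.basis, hj]
    · push Not at hs
      rw [sec_apply_of_ne _ hs, Pi.mulSingle_eq_of_ne (hs j).symm]
  conv_lhs => rw [FreeAb.eq_list_prod v]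
  conv_rhs => rw [FreeAb.eq_list_prod v]
  rw [map_list_prod, map_list_prod, List.map_map, List.map_map]
  congr 2
  funext j
  simp only [Function.comp_apply, map_zpow, h1]
  rw [← hy (τ j) j]
  rfl

/-- Where both sections meet a factor `s`, the hypothesis forces a common index `j`, and both values
are powers of `y s j`. -/
theorem sec_commute (hτ : Function.Injective τ) (hτ' : Function.Injective τ')
    (h : ∀ j j', j ≠ j' → τ j ≠ τ' j') (v w : FreeAb l) :
    Commute (sec y τ v) (sec y τ' w) := by
  funext s
  change Commute (sec y τ v s) (sec y τ' w s)
  by_cases h1 : ∃ j, τ j = s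
  · by_cases h2 : ∃ j, τ' j = s
    · obtain ⟨j, rfl⟩ := h1
      obtain ⟨j', hj'⟩ := h2
      have : j = j' := by
        by_contra hne
        exact h j j' hne hj'.symm
      subst this
      rw [sec_apply hτ, ← hj', sec_apply hτ']
      exact (Commute.refl _).zpow_zpow _ _
    · push Not at h2
      rw [sec_apply_of_ne _ h2]
      exact Commute.one_right _
  · push Not at h1
    rw [sec_apply_of_ne _ h1]
    exact Commute.one_left _

theorem mulSingle_commute_sec (hτ : Function.Injective τ) {s : ι} {j : Fin l}
    (h : ∀ j', j' ≠ j → τ j' ≠ s) (v : FreeAb l) :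
    Commute (Pi.mulSingle s (y s j)) (sec y τ v) := by
  refine commute_mulSingle ?_
  by_cases hs : τ j = s
  · subst hs
    rw [sec_apply hτ]
    exact (Commute.refl _).zpow_right _
  · rw [sec_apply_of_ne _ fun j' => ?_]
    · exact Commute.one_right _
    · by_cases hj : j' = j
      · rwa [hj]
      · exact h j' hj

variable {φ : (ι → FreeGroup Y) →* FreeAb l} (hy : ∀ i j, factor φ i (y i j) = FreeAb.basis j)
  {F Θ : Type*} [Group F] {π : F →* φ.ker} (hπ : Function.Surjective π) {sz : Θ → ℕ}
  [Finite Y] [DecidableEq Y] {A : Set ι} {τ₁ τ₂ : Fin l → ι} {i i' k : ι}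

theorem famMap_twist_sec_eq (hτ : Function.Injective τ) (hτ' : Function.Injective τ')
    (h : ∀ j j', j ≠ j' → τ j ≠ τ' j') (hi : ∀ j, τ j ≠ i) (hi' : ∀ j, τ' j ≠ i)
    {u : Θ → FreeGroup Y} (hu : u ∈ linFam Y sz) (hφ : ∀ θ, factor φ i (u θ) = 1) :
    famMap hπ sz (twist φ (map_sec hy hτ) i) u = famMap hπ sz (twist φ (map_sec hy hτ') i) u :=
  famMap_twist_eq _ _ hπ (sec_commute hτ hτ' h) (fun v => sec_apply_of_ne v hi)
    (fun v => sec_apply_of_ne v hi') hu hφ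

/-- The basic move: if `k` lies outside `A`, then the section that `τ₁` determines may be replaced
by the one that sends the `j`-th basis element to a factor in `A` and the others to factors
outside `A`. -/
theorem famMap_twist_move (hτ₁ : Function.Injective τ₁) (hA₁ : ∀ j, τ₁ j ∈ A)
    (hτ : Function.Injective τ) (hA : ∀ j, τ j ∉ A) {j : Fin l} (hk : k ∉ A)
    (hkj : ∀ j', j' ≠ j → τ j' ≠ k) {s : ι} (hs : s ∈ A)
    {u : Θ → FreeGroup Y} (hu : u ∈ linFam Y sz) (hφ : ∀ θ, factor φ k (u θ) = 1) :
    famMap hπ sz (twist φ (map_sec hy hτ₁) k) u =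
      famMap hπ sz (twist φ (map_sec hy (update_injective hτ j
        fun j' _ (e : τ j' = s) => hA j' (e ▸ hs))) k) u := by
  have hu1 : ∀ s' ∈ A, ∀ j', Function.update τ j s' j' ≠ k := by
    intro s' hs' j' e
    by_cases hj : j' = j
    · subst hj
      rw [Function.update_self] at e
      exact hk (e ▸ hs')
    · rw [Function.update_of_ne hj] at e
      exact hkj j' hj e
  have hinj : Function.Injective (Function.update τ j (τ₁ j)) :=
    update_injective hτ j fun j' _ e => hA j' (e ▸ hA₁ j)
  -- A direct change may fail: if `s = τ₁ j'` with `j' ≠ j`, the two sections need not commute. The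
  -- intermediate `update τ j (τ₁ j)` gives a section commuting with both.
  rw [famMap_twist_sec_eq (i := k) hy hπ hτ₁ hinj _ (fun j' e => hk (e ▸ hA₁ j')) (hu1 _ (hA₁ j)) hu hφ]
  · have hinj' : Function.Injective (Function.update τ j s) :=
      update_injective hτ j fun j' _ e => hA j' (e ▸ hs)
    refine famMap_twist_sec_eq hy hπ hinj hinj' ?_ (hu1 _ (hA₁ j)) (hu1 _ hs) hu hφ
    intro a b hab e
    by_cases ha : a = j
    · subst ha
      rw [Function.update_self, Function.update_of_ne hab.symm] at e
      exact hA b (e ▸ hA₁ a)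
    · by_cases hb : b = j
      · subst hb
        rw [Function.update_self, Function.update_of_ne ha] at e
        exact hA a (e ▸ hs)
      · rw [Function.update_of_ne ha, Function.update_of_ne hb] at e
        exact hab (hτ e)
  · intro a b hab e
    by_cases hb : b = j
    · subst hb
      rw [Function.update_self] at e
      exact hab (hτ₁ e)
    · rw [Function.update_of_ne hb] at e
      exact hA b (e ▸ hA₁ a)

/-- Linear families in the kernels on two factors commute, up to quadratic area. -/
theorem famMap_twist_commute (hτ₁ : Function.Injective τ₁) (hτ₂ : Function.Injective τ₂)
    (hA₁ : ∀ j, τ₁ j ∈ A) (hA₂ : ∀ j, τ₂ j ∉ A) (hi : i ∈ A) (hi' : i' ∈ A) (hne : i' ≠ i)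
    (hk : k ∉ A) {u v : Θ → FreeGroup Y} (hu : u ∈ linFam Y sz) (hv : v ∈ linFam Y sz)
    (hφu : ∀ θ, factor φ i (u θ) = 1) (hφv : ∀ θ, factor φ k (v θ) = 1) :
    Commute (famMap hπ sz (twist φ (map_sec hy hτ₂) i) u)
      (famMap hπ sz (twist φ (map_sec hy hτ₁) k) v) := by
  have hik : i ≠ k := fun e => hk (e ▸ hi)
  -- Both elements are rewritten with one section that avoids `i` and `k`, after which they come
  -- from commuting homomorphisms. `τ₂` serves unless it uses `k`; then that value is replaced by
  -- the spare factor `i'`.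
  by_cases h : ∃ j, τ₂ j = k
  · obtain ⟨j, rfl⟩ := h
    rw [famMap_twist_move hy hπ hτ₁ hA₁ hτ₂ hA₂ hk (fun j' hj' => hτ₂.ne hj') hi' hv hφv]
    have h1 : ∀ j', Function.update τ₂ j i' j' ≠ i := by
      intro j' e
      by_cases hj : j' = j
      · subst hj
        rw [Function.update_self] at e
        exact hne e
      · rw [Function.update_of_ne hj] at e
        exact hA₂ j' (e ▸ hi)
    have h2 : ∀ j', Function.update τ₂ j i' j' ≠ τ₂ j := by
      intro j' e
      by_cases hj : j' = j
      · subst hj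
        rw [Function.update_self] at e
        exact hk (e ▸ hi')
      · rw [Function.update_of_ne hj] at e
        exact hj (hτ₂ e)
    have hinj : Function.Injective (Function.update τ₂ j i') :=
      update_injective hτ₂ j fun j' _ e => hA₂ j' (e ▸ hi')
    rw [famMap_twist_sec_eq hy hπ hτ₂ hinj _ (fun j' e => hA₂ j' (e ▸ hi)) h1 hu hφu]
    · exact famMap_commute hπ (twist_commute _ _ hik (fun v => sec_apply_of_ne v h1)
        (fun v => sec_apply_of_ne v h2) (fun v => sec_apply_of_ne v h1)
        (fun v => sec_apply_of_ne v h2) fun v w => (Commute.all v w).map _) hu hv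
    · intro a b hab e
      by_cases hb : b = j
      · subst hb
        rw [Function.update_self] at e
        exact hA₂ a (e ▸ hi')
      · rw [Function.update_of_ne hb] at e
        exact hab (hτ₂ e)
  · push Not at h
    rw [famMap_twist_sec_eq (i := k) hy hπ hτ₁ hτ₂ (fun a b _ e => hA₂ b (e ▸ hA₁ a))
      (fun j' e => hk (e ▸ hA₁ j')) h hv hφv]
    have h1 : ∀ j', τ₂ j' ≠ i := fun j' e => hA₂ j' (e ▸ hi)
    exact famMap_commute hπ (twist_commute _ _ hik (fun v => sec_apply_of_ne v h1)
        (fun v => sec_apply_of_ne v h) (fun v => sec_apply_of_ne v h1)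
        (fun v => sec_apply_of_ne v h) fun v w => (Commute.all v w).map _) hu hv

/-- Linear families of powers of a difference of two lifts of a basis element commute with linear
families in the kernel on a factor, up to quadratic area. -/
theorem famMap_zpowers_commute_twist (hτ₁ : Function.Injective τ₁) (hτ₂ : Function.Injective τ₂)
    (hA₁ : ∀ j, τ₁ j ∈ A) (hA₂ : ∀ j, τ₂ j ∉ A) (hi : i ∈ A) (hi' : i' ∈ A)
    (hk : k ∉ A) {j : Fin l} {f : FreeGroup Y →* φ.ker}
    (hf : ∀ x, (f x : ι → FreeGroup Y) ∈ Subgroup.zpowers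
      (Pi.mulSingle i (y i j) * (Pi.mulSingle i' (y i' j))⁻¹))
    {u v : Θ → FreeGroup Y} (hu : u ∈ linFam Y sz) (hv : v ∈ linFam Y sz)
    (hφv : ∀ θ, factor φ k (v θ) = 1) :
    Commute (famMap hπ sz f u) (famMap hπ sz (twist φ (map_sec hy hτ₁) k) v) := by
  -- The swap makes `τ j = k`. Once this value is replaced by `i`, the section avoids `k` and meets
  -- `A` only in the factor `i`, in powers of `y i j`; so it commutes with `y i j` and `y i' j` in
  -- their factors.
  set τ : Fin l → ι := Equiv.swap k (τ₂ j) ∘ τ₂ with hτdef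
  have hτ : Function.Injective τ := (Equiv.injective _).comp hτ₂
  have hA : ∀ j', τ j' ∉ A := by
    intro j'
    simp only [hτdef, Function.comp_apply]
    rw [Equiv.swap_apply_def]
    split_ifs
    exacts [hA₂ _, hk, hA₂ _]
  have hkj : ∀ j', j' ≠ j → τ j' ≠ k := by
    intro j' hj e
    have h1 : τ j = k := by simp [hτdef]
    exact hj (hτ (e.trans h1.symm))
  rw [famMap_twist_move hy hπ hτ₁ hA₁ hτ hA hk hkj hi hv hφv]
  refine famMap_commute hπ (fun x z => ?_) hu hv
  apply Subtype.ext
  change Commute (f x : ι → FreeGroup Y) _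
  have hk' : ∀ j', Function.update τ j i j' ≠ k := by
    intro j' e
    by_cases hj : j' = j
    · subst hj
      rw [Function.update_self] at e
      exact hk (e ▸ hi)
    · rw [Function.update_of_ne hj] at e
      exact hkj j' hj e
  have hA' : ∀ s ∈ A, ∀ j', j' ≠ j → Function.update τ j i j' ≠ s := by
    intro s hs j' hj e
    rw [Function.update_of_ne hj] at e
    exact hA j' (e ▸ hs)
  have hinj : Function.Injective (Function.update τ j i) :=
    update_injective hτ j fun j' _ e => hA j' (e ▸ hi)
  rw [coe_twist _ fun v => sec_apply_of_ne v hk']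
  obtain ⟨n, hn⟩ := Subgroup.mem_zpowers_iff.1 (hf x)
  rw [← hn]
  refine Commute.zpow_left (Commute.mul_right (Commute.mul_left ?_ (Commute.inv_left ?_))
    (Commute.inv_right (Commute.mul_left ?_ (Commute.inv_left ?_)))) n
  · exact commute_mulSingle (by simp [Pi.mulSingle_eq_of_ne (fun e : i = k => hk (e ▸ hi))])
  · exact commute_mulSingle (by simp [Pi.mulSingle_eq_of_ne (fun e : i' = k => hk (e ▸ hi'))])
  · exact mulSingle_commute_sec hinj (hA' i hi) _
  · exact mulSingle_commute_sec hinj (hA' i' hi') _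

end Sections

/-! ### Products over lists of factors, and linear families. -/

theorem List.prod_map_mul_of_commute {ι M : Type*} [Monoid M] (a b : ι → M) {L : List ι}
    (hL : L.Nodup) (h : ∀ i ∈ L, ∀ j ∈ L, i ≠ j → Commute (b i) (a j)) :
    (L.map fun i => a i * b i).prod = (L.map a).prod * (L.map b).prod := by
  induction L with
  | nil => simp
  | cons i L ih =>
    have hi : Commute (b i) (L.map a).prod := by
      refine Commute.list_prod_right _ _ fun z hz => ?_
      obtain ⟨j, hj, rfl⟩ := List.mem_map.1 hz
      exact h i List.mem_cons_self j (List.mem_cons_of_mem _ hj)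
        fun e => (List.nodup_cons.1 hL).1 (e ▸ hj)
    rw [List.map_cons, List.map_cons, List.map_cons, List.prod_cons, List.prod_cons,
      List.prod_cons, ih (List.nodup_cons.1 hL).2 fun i hi j hj => h i (List.mem_cons_of_mem _ hi) j
        (List.mem_cons_of_mem _ hj), mul_assoc, ← mul_assoc (b i), hi.eq]
    simp only [mul_assoc]

section Restrict

variable {ι Y : Type*} [DecidableEq ι] {l : ℕ}

/-- The restriction of a family to the indices in a list. -/
def restrict (L : List ι) : (ι → FreeGroup Y) →* (ι → FreeGroup Y) where
  toFun g s := if s ∈ L then g s else 1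
  map_one' := by
    funext s
    simp
  map_mul' g h := by
    funext s
    by_cases hs : s ∈ L <;> simp [hs]

theorem restrict_apply (L : List ι) (g : ι → FreeGroup Y) (s : ι) :
    restrict L g s = if s ∈ L then g s else 1 := rfl

theorem restrict_cons {i : ι} {L : List ι} (hi : i ∉ L) (g : ι → FreeGroup Y) :
    restrict (i :: L) g = Pi.mulSingle i (g i) * restrict L g := by
  funext s
  by_cases hs : s = i
  · subst hs
    simp [restrict_apply, hi]
  · simp [restrict_apply, hs]

theorem map_restrict (φ : (ι → FreeGroup Y) →* FreeAb l) {L : List ι} (hL : L.Nodup)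
    (g : ι → FreeGroup Y) :
    φ (restrict L g) = (L.map fun i => factor φ i (g i)).prod := by
  induction L with
  | nil =>
    have : restrict [] g = 1 := by
      funext s
      simp [restrict_apply]
    simp [this]
  | cons i L ih =>
    rw [restrict_cons (List.nodup_cons.1 hL).1, map_mul, ih (List.nodup_cons.1 hL).2]
    rfl

theorem coe_list_prod_twist {φ : (ι → FreeGroup Y) →* FreeAb l}
    {σ : FreeAb l →* (ι → FreeGroup Y)} (hσ : ∀ v, φ (σ v) = v) {L : List ι} (hL : L.Nodup)
    (hσL : ∀ i ∈ L, ∀ v, σ v i = 1) (g : ι → FreeGroup Y) :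
    ((L.map fun i => twist φ hσ i (g i)).prod : ι → FreeGroup Y) =
      restrict L g * (σ (φ (restrict L g)))⁻¹ := by
  induction L with
  | nil =>
    have : restrict [] g = 1 := by
      funext s
      simp [restrict_apply]
    simp [this]
  | cons i L ih =>
    have hi := hσL i List.mem_cons_self
    have hL' := fun j hj => hσL j (List.mem_cons_of_mem i hj)
    have h1 : Commute (σ (factor φ i (g i)))⁻¹ (restrict L g) := by
      funext s
      by_cases hs : s ∈ L
      · simp [hL' s hs]
      · simp [restrict_apply, hs]
    have h2 : φ (Pi.mulSingle i (g i)) = factor φ i (g i) := rfl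
    have h3 : Commute (σ (factor φ i (g i)))⁻¹ (σ (φ (restrict L g)))⁻¹ :=
      ((Commute.all _ _).map σ).inv_inv
    rw [List.map_cons, List.prod_cons, Subgroup.coe_mul, ih (List.nodup_cons.1 hL).2 hL',
      coe_twist hσ hi, restrict_cons (List.nodup_cons.1 hL).1, map_mul, map_mul, h2, mul_inv_rev,
      ← h3.eq, mul_assoc, ← mul_assoc _ (restrict L g), h1.eq]
    simp only [mul_assoc]

end Restrict

section Linear

variable {ι Y Θ : Type*} [DecidableEq Y] {sz : Θ → ℕ}

/-- Families of elements of the direct product all of whose components are linear. -/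
def IsLin (sz : Θ → ℕ) (g : Θ → ι → FreeGroup Y) : Prop :=
  ∀ s, (fun θ => g θ s) ∈ linFam Y sz

theorem IsLin.mul {g h : Θ → ι → FreeGroup Y} (hg : IsLin sz g) (hh : IsLin sz h) :
    IsLin sz (fun θ => g θ * h θ) := fun s => (linFam Y sz).mul_mem (hg s) (hh s)

theorem IsLin.inv {g : Θ → ι → FreeGroup Y} (hg : IsLin sz g) : IsLin sz (fun θ => (g θ)⁻¹) :=
  fun s => (linFam Y sz).inv_mem (hg s)

end Linear

/-! ### The two parts, and the commutation of their kernels. -/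

/-- A division of the factors of a direct product of free groups into two parts, such that
the standard basis of the free abelian group can be lifted to distinct factors in each part. -/
structure Splitting {ι Y : Type*} [DecidableEq ι] {l : ℕ} (φ : (ι → FreeGroup Y) →* FreeAb l) where
  y : ι → Fin l → FreeGroup Y
  factor_y : ∀ i j, factor φ i (y i j) = FreeAb.basis j
  L₁ : List ι
  L₂ : List ι
  nodup₁ : L₁.Nodup
  nodup₂ : L₂.Nodup
  mem_iff : ∀ i, i ∈ L₁ ↔ i ∉ L₂
  ne₁ : ∀ i ∈ L₁, ∃ i' ∈ L₁, i' ≠ i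
  ne₂ : ∀ i ∈ L₂, ∃ i' ∈ L₂, i' ≠ i
  τ₁ : Fin l → ι
  τ₂ : Fin l → ι
  inj₁ : Function.Injective τ₁
  inj₂ : Function.Injective τ₂
  mem₁ : ∀ j, τ₁ j ∈ L₁
  mem₂ : ∀ j, τ₂ j ∈ L₂

namespace Splitting

variable {ι Y : Type*} [DecidableEq ι] {l : ℕ} {φ : (ι → FreeGroup Y) →* FreeAb l}
  (D : Splitting φ)

/-- The splitting with the two parts exchanged. -/
@[simps]
def swap : Splitting φ where
  y := D.y
  factor_y := D.factor_y
  L₁ := D.L₂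
  L₂ := D.L₁
  nodup₁ := D.nodup₂
  nodup₂ := D.nodup₁
  mem_iff i := by rw [D.mem_iff, not_not]
  ne₁ := D.ne₂
  ne₂ := D.ne₁
  τ₁ := D.τ₂
  τ₂ := D.τ₁
  inj₁ := D.inj₂
  inj₂ := D.inj₁
  mem₁ := D.mem₂
  mem₂ := D.mem₁

/-- The section of `φ` with values in the first part. -/
noncomputable def σ : FreeAb l →* (ι → FreeGroup Y) := sec D.y D.τ₁

theorem map_σ (v : FreeAb l) : φ (D.σ v) = v := map_sec D.factor_y D.inj₁ v

theorem σ_apply {i : ι} (hi : i ∈ D.L₂) (v : FreeAb l) : D.σ v i = 1 :=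
  sec_apply_of_ne v fun j e => (D.mem_iff i).1 (e ▸ D.mem₁ j) hi

theorem swap_σ_apply {i : ι} (hi : i ∈ D.L₁) (v : FreeAb l) : D.swap.σ v i = 1 :=
  D.swap.σ_apply hi v

theorem restrict_σ (v : FreeAb l) : restrict D.L₁ (D.σ v) = D.σ v := by
  funext s
  rw [restrict_apply]
  split_ifs with h
  · rfl
  · rw [D.σ_apply]
    rwa [D.mem_iff, not_not] at h

theorem σ_commute (v w : FreeAb l) : Commute (D.σ v) (D.swap.σ w) :=
  sec_commute D.inj₁ D.inj₂ (fun j j' _ e => (D.mem_iff _).1 (D.mem₁ j) (e ▸ D.mem₂ j')) v w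

theorem restrict_mul_restrict (g : ι → FreeGroup Y) :
    restrict D.L₁ g * restrict D.L₂ g = g := by
  funext s
  have := D.mem_iff s
  by_cases h : s ∈ D.L₂ <;> simp [restrict_apply, h, this]

/-- The embedding of a factor in the first part, corrected in the second part. -/
noncomputable def tw (i : ι) : FreeGroup Y →* φ.ker := twist φ D.swap.map_σ i

theorem tw_commute {i k : ι} (hi : i ∈ D.L₁) (hk : k ∈ D.L₁) (hik : i ≠ k) (x z : FreeGroup Y) :
    Commute (D.tw i x) (D.tw k z) :=
  twist_commute _ _ hik (D.swap_σ_apply hi) (D.swap_σ_apply hk) (D.swap_σ_apply hi)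
    (D.swap_σ_apply hk) (fun v w => (Commute.all v w).map _) x z

theorem coe_list_prod_tw (g : ι → FreeGroup Y) :
    ((D.L₁.map fun i => D.tw i (g i)).prod : ι → FreeGroup Y) =
      restrict D.L₁ g * (D.swap.σ (φ (restrict D.L₁ g)))⁻¹ :=
  coe_list_prod_twist _ D.nodup₁ (fun _ hi => D.swap_σ_apply hi) g

variable {F Θ : Type*} [Group F] {π : F →* φ.ker} (hπ : Function.Surjective π) {sz : Θ → ℕ}

/-- The map from families in the first part to families of words over the kernel of `φ`. -/
noncomputable def half (sz : Θ → ℕ) (g : Θ → ι → FreeGroup Y) : (Θ → F) ⧸ quadNull π sz :=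
  (D.L₁.map fun i => famMap hπ sz (D.tw i) (fun θ => g θ i)).prod

/-- In `K` the product of the `tw i (σ v i)` is `σ v * (σ' v)⁻¹`, with `σ'` the section in the other
part, and this is a homomorphism in `v`. The map `ζ` provides the free domain that `famMap`
requires. -/
theorem half_σ {W : Type*} [Finite W] [DecidableEq W] (ζ : FreeGroup W →* FreeAb l)
    {v : Θ → FreeGroup W} (hv : v ∈ linFam W sz) :
    D.half hπ sz (fun θ => D.σ (ζ (v θ))) =
      famMap hπ sz ((sectionDiff D.map_σ D.swap.map_σ D.σ_commute).comp ζ) v := by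
  rw [famMap_list_prod hπ
    (fun i => (D.tw i).comp ((Pi.evalMonoidHom (fun _ => FreeGroup Y) i).comp (D.σ.comp ζ)))
    D.nodup₁ _ _ _ hv]
  · rw [half]
    congr 2
    funext i
    rw [famMap_comp hπ _ _ hv]
    rfl
  · intro i hi j hj hij x z
    exact D.tw_commute hi hj hij _ _
  · intro x
    apply Subtype.ext
    have := D.coe_list_prod_tw (D.σ (ζ x))
    rw [D.restrict_σ, D.map_σ] at this
    exact this.symm

/-- The images of the section in the two parts agree up to sign. -/
theorem half_σ_mul_half_swap_σ {W : Type*} [Finite W] [DecidableEq W] (ζ : FreeGroup W →* FreeAb l)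
    {v : Θ → FreeGroup W} (hv : v ∈ linFam W sz) :
    D.half hπ sz (fun θ => D.σ (ζ (v θ))) * D.swap.half hπ sz (fun θ => D.swap.σ (ζ (v θ))) = 1 := by
  rw [D.half_σ hπ ζ hv, D.swap.half_σ hπ ζ hv, ← famMap_mul hπ _ _ hv (k := 1), famMap_one hπ hv]
  · intro x z
    apply Subtype.ext
    refine Commute.mul_left (Commute.mul_right ?_ ?_) (Commute.mul_right ?_ ?_)
    · exact D.σ_commute _ _
    · exact (((Commute.all _ _).map D.σ)).inv_right
    · exact (((Commute.all _ _).map D.swap.σ)).inv_left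
    · exact (D.σ_commute _ _).symm.inv_inv
  · intro x
    apply Subtype.ext
    change (1 : ι → FreeGroup Y) = D.σ (ζ x) * (D.swap.σ (ζ x))⁻¹ * (D.swap.σ (ζ x) * (D.σ (ζ x))⁻¹)
    group

variable [Finite Y] [DecidableEq Y]

theorem half_mul {g h : Θ → ι → FreeGroup Y} (hg : IsLin sz g) (hh : IsLin sz h) :
    D.half hπ sz (fun θ => g θ * h θ) = D.half hπ sz g * D.half hπ sz h := by
  have := List.prod_map_mul_of_commute (fun i => famMap hπ sz (D.tw i) (fun θ => g θ i))
    (fun i => famMap hπ sz (D.tw i) (fun θ => h θ i)) D.nodup₁ fun i hi j hj hij =>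
      famMap_commute hπ (D.tw_commute hi hj hij) (hh i) (hg j)
  rw [half, half, half, ← this]
  congr 2
  funext i
  rw [← map_mul]
  rfl

theorem half_inv {g : Θ → ι → FreeGroup Y} (hg : IsLin sz g) :
    D.half hπ sz (fun θ => (g θ)⁻¹) = (D.half hπ sz g)⁻¹ := by
  rw [eq_inv_iff_mul_eq_one, ← D.half_mul hπ hg.inv hg]
  refine List.prod_eq_one ?_
  simp only [List.mem_map]
  rintro _ ⟨i, -, rfl⟩
  convert map_one (famMap hπ sz (D.tw i)) using 2
  funext θ
  simp

/-- The elements that generate the image of the kernel of `φ` on the first part. -/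
def gens (sz : Θ → ℕ) : Set ((Θ → F) ⧸ quadNull π sz) :=
  {z | ∃ i ∈ D.L₁, ∃ u ∈ linFam Y sz, (∀ θ, factor φ i (u θ) = 1) ∧
    z = famMap hπ sz (D.tw i) u} ∪
  {z | ∃ i ∈ D.L₁, ∃ i' ∈ D.L₁, ∃ j, ∃ f : FreeGroup Y →* φ.ker,
    (∀ x, (f x : ι → FreeGroup Y) ∈ Subgroup.zpowers
      (Pi.mulSingle i (D.y i j) * (Pi.mulSingle i' (D.y i' j))⁻¹)) ∧
    ∃ u ∈ linFam Y sz, z = famMap hπ sz f u}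

/-- Pairs involving a twisted element are handled by changing its section; two differences of lifts
have disjoint supports and commute in `K`. -/
theorem gens_commute {z z' : (Θ → F) ⧸ quadNull π sz} (hz : z ∈ D.gens hπ sz)
    (hz' : z' ∈ D.swap.gens hπ sz) : Commute z z' := by
  have hd : ∀ i ∈ D.L₂, i ∉ D.L₁ := fun i hi h => (D.mem_iff i).1 h hi
  have hd' : ∀ i ∈ D.L₁, i ∉ D.L₂ := fun i hi => (D.mem_iff i).1 hi
  rcases hz with ⟨i, hi, u, hu, hφu, rfl⟩ | ⟨i, hi, i', hi', j, f, hf, u, hu, rfl⟩ <;>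
    rcases hz' with ⟨k, hk, v, hv, hφv, rfl⟩ | ⟨k, hk, k', hk', j', f', hf', v, hv, rfl⟩
  · obtain ⟨i', hi', hne⟩ := D.ne₁ i hi
    exact famMap_twist_commute (A := {i | i ∈ D.L₁}) D.factor_y hπ D.inj₁ D.inj₂ D.mem₁
      (fun j => hd _ (D.mem₂ j)) hi hi' hne (hd k hk) hu hv hφu hφv
  · exact (famMap_zpowers_commute_twist (A := {i | i ∈ D.L₂}) D.factor_y hπ D.inj₂ D.inj₁ D.mem₂
      (fun j => hd' _ (D.mem₁ j)) hk hk' (hd' i hi) hf' hv hu hφu).symm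
  · exact famMap_zpowers_commute_twist (A := {i | i ∈ D.L₁}) D.factor_y hπ D.inj₁ D.inj₂ D.mem₁
      (fun j => hd _ (D.mem₂ j)) hi hi' (hd k hk) hf hu hv hφv
  · refine famMap_commute hπ (fun x y => ?_) hu hv
    apply Subtype.ext
    obtain ⟨n, hn⟩ := Subgroup.mem_zpowers_iff.1 (hf x)
    obtain ⟨n', hn'⟩ := Subgroup.mem_zpowers_iff.1 (hf' y)
    change Commute (f x : ι → FreeGroup Y) (f' y : ι → FreeGroup Y)
    rw [← hn, ← hn']
    have h1 : ∀ a ∈ D.L₁, ∀ b ∈ D.L₂, ∀ p q : FreeGroup Y,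
        Commute (Pi.mulSingle a p : ι → FreeGroup Y) (Pi.mulSingle b q) := by
      intro a ha b hb p q
      refine commute_mulSingle ?_
      rw [Pi.mulSingle_eq_of_ne (fun e : a = b => hd' a ha (e ▸ hb))]
      exact Commute.one_right _
    exact Commute.zpow_zpow (Commute.mul_left
      (Commute.mul_right (h1 _ hi _ hk _ _) (h1 _ hi _ hk' _ _).inv_right)
      (Commute.mul_right (h1 _ hi' _ hk _ _).inv_left (h1 _ hi' _ hk' _ _).inv_inv)) _ _

theorem closure_gens_commute {z z' : (Θ → F) ⧸ quadNull π sz}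
    (hz : z ∈ Subgroup.closure (D.gens hπ sz)) (hz' : z' ∈ Subgroup.closure (D.swap.gens hπ sz)) :
    Commute z z' := by
  have h1 : Subgroup.closure (D.swap.gens hπ sz) ≤ Subgroup.centralizer (D.gens hπ sz) := by
    rw [Subgroup.closure_le]
    intro w' hw'
    exact Subgroup.mem_centralizer_iff.2 fun w hw => (D.gens_commute hπ hw hw').eq
  have h2 : Subgroup.closure (D.gens hπ sz) ≤
      Subgroup.centralizer (Subgroup.closure (D.swap.gens hπ sz)) := by
    rw [Subgroup.closure_le]
    intro w hw
    exact Subgroup.mem_centralizer_iff.2 fun w' hw' =>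
      (Subgroup.mem_centralizer_iff.1 (h1 hw') w hw).symm
  exact (Subgroup.mem_centralizer_iff.1 (h2 hz) z' hz').symm

/-- Up to elements of the kernel, a family in one factor may be moved to another factor. -/
theorem exists_famMap_tw_mul_inv_mem {i k : ι} (hi : i ∈ D.L₁) (hk : k ∈ D.L₁) (hik : i ≠ k)
    {u : Θ → FreeGroup Y} (hu : u ∈ linFam Y sz) :
    ∃ w ∈ linFam Y sz, (∀ θ, factor φ k (w θ) = factor φ i (u θ)) ∧
      famMap hπ sz (D.tw i) u * (famMap hπ sz (D.tw k) w)⁻¹ ∈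
        Subgroup.closure (D.gens hπ sz) := by
  let χ : Fin l → FreeGroup Y →* Multiplicative ℤ := fun j =>
    (FreeAb.coord j).comp (factor φ i)
  let a : Fin l → FreeGroup Y →* FreeGroup Y := fun j =>
    (zpowersHom (FreeGroup Y) (D.y i j)).comp (χ j)
  let b : Fin l → FreeGroup Y →* FreeGroup Y := fun j =>
    (zpowersHom (FreeGroup Y) (D.y k j)⁻¹).comp (χ j)
  have hlin : ∀ c : Fin l → FreeGroup Y →* FreeGroup Y,
      ((List.finRange l).map fun j θ => c j (u θ)).prod ∈ linFam Y sz := by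
    intro c
    refine Subgroup.list_prod_mem _ fun z hz => ?_
    obtain ⟨j, -, rfl⟩ := List.mem_map.1 hz
    exact linFam_map _ hu
  have hev : ∀ (c : Fin l → FreeGroup Y →* FreeGroup Y) (θ : Θ),
      (((List.finRange l).map fun j θ => c j (u θ)).prod : Θ → FreeGroup Y) θ =
        ((List.finRange l).map fun j => c j (u θ)).prod := by
    intro c θ
    have := map_list_prod (Pi.evalMonoidHom (fun _ : Θ => FreeGroup Y) θ)
      ((List.finRange l).map fun j θ => c j (u θ))
    rwa [List.map_map] at this
  -- `p` and `q` represent `factor φ i u` and its inverse by fixed lifts of the basis in the factors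
  -- `i` and `k`. Then `u * p⁻¹` is killed by `factor φ i`, the product of `p` and `q` consists of
  -- powers of differences of lifts, and `w = q⁻¹`.
  set p : Θ → FreeGroup Y := ((List.finRange l).map fun j θ => a j (u θ)).prod with hp
  set q : Θ → FreeGroup Y := ((List.finRange l).map fun j θ => b j (u θ)).prod with hq
  have hφp : ∀ θ, factor φ i (p θ) = factor φ i (u θ) := by
    intro θ
    rw [hp, hev, map_list_prod, List.map_map]
    conv_rhs => rw [FreeAb.eq_list_prod (factor φ i (u θ))]
    congr 2
    funext j
    simp [a, χ, zpowersHom_apply, D.factor_y]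
  have hφq : ∀ θ, factor φ k (q θ) = (factor φ i (u θ))⁻¹ := by
    intro θ
    rw [hq, hev, map_list_prod, List.map_map]
    conv_rhs => rw [FreeAb.eq_list_prod (factor φ i (u θ))⁻¹]
    congr 2
    funext j
    simp [b, χ, zpowersHom_apply, D.factor_y]
  refine ⟨q⁻¹, (linFam Y sz).inv_mem (hlin b), fun θ => ?_, ?_⟩
  · rw [Pi.inv_apply, map_inv, hφq, inv_inv]
  have h1 : famMap hπ sz (D.tw i) u * (famMap hπ sz (D.tw k) q⁻¹)⁻¹ =
      famMap hπ sz (D.tw i) (u * p⁻¹) *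
        (famMap hπ sz (D.tw i) p * famMap hπ sz (D.tw k) q) := by
    simp only [map_mul, map_inv]
    group
  rw [h1]
  refine mul_mem (Subgroup.subset_closure (Or.inl ⟨i, hi, _, (linFam Y sz).mul_mem hu
    ((linFam Y sz).inv_mem (hlin a)), fun θ => ?_, rfl⟩)) ?_
  · rw [Pi.mul_apply, Pi.inv_apply, map_mul, map_inv, hφp, mul_inv_cancel]
  · rw [hp, hq, map_list_prod, map_list_prod, List.map_map, List.map_map,
      ← List.prod_map_mul_of_commute _ _ (List.nodup_finRange l)]
    · refine Subgroup.list_prod_mem _ fun z hz => ?_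
      obtain ⟨j, -, rfl⟩ := List.mem_map.1 hz
      have hcomm : Commute (D.tw i (D.y i j)) (D.tw k (D.y k j))⁻¹ :=
        (D.tw_commute hi hk hik _ _).inv_right
      refine Subgroup.subset_closure (Or.inr ⟨i, hi, k, hk, j,
        (zpowersHom φ.ker (D.tw i (D.y i j) * (D.tw k (D.y k j))⁻¹)).comp (χ j),
        fun x => ?_, u, hu, ?_⟩)
      · refine Subgroup.mem_zpowers_iff.2 ⟨(χ j x).toAdd, ?_⟩
        change _ = (((D.tw i (D.y i j) * (D.tw k (D.y k j))⁻¹) ^ (χ j x).toAdd : φ.ker) :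
          ι → FreeGroup Y)
        rw [Subgroup.coe_zpow, Subgroup.coe_mul, Subgroup.coe_inv, tw, tw, coe_twist _ (D.swap_σ_apply hi),
          coe_twist _ (D.swap_σ_apply hk), D.factor_y, D.factor_y]
        congr 1
        group
      · rw [famMap_mul hπ (f := (D.tw i).comp (a j)) (g := (D.tw k).comp (b j)) _ _ hu,
          famMap_comp hπ _ _ hu, famMap_comp hπ _ _ hu]
        · rfl
        · exact fun x z => D.tw_commute hi hk hik _ _
        · intro x
          simp only [MonoidHom.comp_apply, zpowersHom_apply, a, b, map_zpow, map_inv]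
          exact hcomm.mul_zpow _
    · intro j _ j' _ _
      exact (famMap_commute hπ (D.tw_commute hi hk hik) (linFam_map _ hu) (linFam_map _ hu)).symm

/-- Modulo `gens`, all components are moved into a single factor `k`; by hypothesis what accumulates
there is killed by `factor φ k`. -/
theorem half_mem_closure_gens {g : Θ → ι → FreeGroup Y} (hg : IsLin sz g)
    (hφ : ∀ θ, φ (restrict D.L₁ (g θ)) = 1) :
    D.half hπ sz g ∈ Subgroup.closure (D.gens hπ sz) := by
  have hφ' : ∀ θ, (D.L₁.map fun i => factor φ i (g θ i)).prod = 1 := fun θ => by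
    rw [← map_restrict φ D.nodup₁, hφ]
  have hnodup := D.nodup₁
  have hmem : ∀ i ∈ D.L₁, i ∈ D.L₁ := fun _ h => h
  rw [half]
  generalize hL : D.L₁ = L at hφ' hnodup
  replace hmem : ∀ i ∈ L, i ∈ D.L₁ := fun i h => hL ▸ h
  clear hL
  rcases L with _ | ⟨k, L⟩
  · exact one_mem _
  have hk := hmem k List.mem_cons_self
  have key : ∀ M : List ι, (∀ i ∈ M, i ∈ L) → M.Nodup → ∃ w ∈ linFam Y sz,
      (∀ θ, factor φ k (w θ) = (M.map fun i => factor φ i (g θ i)).prod) ∧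
      (M.map fun i => famMap hπ sz (D.tw i) (fun θ => g θ i)).prod *
        (famMap hπ sz (D.tw k) w)⁻¹ ∈ Subgroup.closure (D.gens hπ sz) := by
    intro M
    induction M with
    | nil =>
      intro _ _
      exact ⟨1, one_mem _, by simp, by simp⟩
    | cons i M ih =>
      intro hM hMn
      obtain ⟨w, hw, hφw, hmw⟩ := ih (fun j hj => hM j (List.mem_cons_of_mem _ hj))
        (List.nodup_cons.1 hMn).2
      have hiL := hM i List.mem_cons_self
      have hi := hmem i (List.mem_cons_of_mem _ hiL)
      have hik : i ≠ k := fun e => (List.nodup_cons.1 hnodup).1 (e ▸ hiL)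
      obtain ⟨w', hw', hφw', hmw'⟩ := D.exists_famMap_tw_mul_inv_mem hπ hi hk hik (hg i)
      refine ⟨w' * w, mul_mem hw' hw, fun θ => ?_, ?_⟩
      · rw [Pi.mul_apply, map_mul, hφw, hφw', List.map_cons, List.prod_cons]
      · have h1 : Commute (famMap hπ sz (D.tw i) fun θ => g θ i)
            (M.map fun i => famMap hπ sz (D.tw i) (fun θ => g θ i)).prod := by
          refine Commute.list_prod_right _ _ fun z hz => ?_
          obtain ⟨j, hj, rfl⟩ := List.mem_map.1 hz
          exact famMap_commute hπ (D.tw_commute hi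
            (hmem j (List.mem_cons_of_mem _ (hM j (List.mem_cons_of_mem _ hj))))
            fun e => (List.nodup_cons.1 hMn).1 (e ▸ hj)) (hg i) (hg j)
        have h2 : Commute (famMap hπ sz (D.tw i) fun θ => g θ i) (famMap hπ sz (D.tw k) w)⁻¹ :=
          (famMap_commute hπ (D.tw_commute hi hk hik) (hg i) hw).inv_right
        have := mul_mem hmw hmw'
        rw [mul_assoc, ← mul_assoc (famMap hπ sz (D.tw k) w)⁻¹, ← h2.eq] at this
        rw [List.map_cons, List.prod_cons, h1.eq, map_mul, mul_inv_rev]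
        simpa only [mul_assoc] using this
  obtain ⟨w, hw, hφw, hmw⟩ := key L (fun _ h => h) (List.nodup_cons.1 hnodup).2
  have h1 : Commute (famMap hπ sz (D.tw k) fun θ => g θ k)
      (L.map fun i => famMap hπ sz (D.tw i) (fun θ => g θ i)).prod := by
    refine Commute.list_prod_right _ _ fun z hz => ?_
    obtain ⟨j, hj, rfl⟩ := List.mem_map.1 hz
    exact famMap_commute hπ (D.tw_commute hk (hmem j (List.mem_cons_of_mem _ hj))
      fun e => (List.nodup_cons.1 hnodup).1 (e ▸ hj)) (hg k) (hg j)
  have h2 : famMap hπ sz (D.tw k) (w * fun θ => g θ k) ∈ Subgroup.closure (D.gens hπ sz) := by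
    refine Subgroup.subset_closure (Or.inl ⟨k, hk, _, mul_mem hw (hg k), fun θ => ?_, rfl⟩)
    have := hφ' θ
    rw [List.map_cons, List.prod_cons, ← hφw] at this
    rw [Pi.mul_apply, map_mul, mul_comm]
    exact this
  have := mul_mem hmw h2
  rw [List.map_cons, List.prod_cons, h1.eq]
  rwa [map_mul, mul_assoc, inv_mul_cancel_left] at this

theorem half_commute_half {g h : Θ → ι → FreeGroup Y} (hg : IsLin sz g) (hh : IsLin sz h)
    (hφg : ∀ θ, φ (restrict D.L₁ (g θ)) = 1) (hφh : ∀ θ, φ (restrict D.L₂ (h θ)) = 1) :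
    Commute (D.half hπ sz g) (D.swap.half hπ sz h) :=
  D.closure_gens_commute hπ (D.half_mem_closure_gens hπ hg hφg)
    (D.swap.half_mem_closure_gens hπ hh hφh)

end Splitting

/-! ### Normal forms and their triangles. -/

theorem isLin_map {ι Y X Θ : Type*} [DecidableEq Y] [Finite X] [DecidableEq X] {sz : Θ → ℕ}
    (f : FreeGroup X →* (ι → FreeGroup Y)) {p : Θ → FreeGroup X}
    (hp : p ∈ linFam X sz) : IsLin sz (fun θ => f (p θ)) :=
  fun s => linFam_map ((Pi.evalMonoidHom (fun _ => FreeGroup Y) s).comp f) hp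

theorem mk_list_prod_liftHom {ι X Y K Θ : Type*} [Group K] {π : FreeGroup X →* K}
    (hπ : Function.Surjective π) {sz : Θ → ℕ} (f : ι → FreeGroup Y →* K) (L : List ι)
    (g : Θ → ι → FreeGroup Y) :
    ((fun θ => (L.map fun i => liftHom hπ (f i) (g θ i)).prod : Θ → FreeGroup X) :
      (Θ → FreeGroup X) ⧸ quadNull π sz) =
      (L.map fun i => famMap hπ sz (f i) (fun θ => g θ i)).prod := by
  induction L with
  | nil => rfl
  | cons i L ih =>
    rw [List.map_cons, List.prod_cons, ← ih]
    rfl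

namespace Splitting

variable {ι Y X : Type*} [DecidableEq ι] {l : ℕ} {φ : (ι → FreeGroup Y) →* FreeAb l}
  (D : Splitting φ)

/-- The component in the second part of the decomposition of an element. -/
noncomputable def rest (g : ι → FreeGroup Y) : ι → FreeGroup Y :=
  D.swap.σ (φ (restrict D.L₁ g)) * g

theorem map_restrict_rest (g : ι → FreeGroup Y) : φ (restrict D.L₂ (D.rest g)) = φ g := by
  have h1 : restrict D.L₂ (D.swap.σ (φ (restrict D.L₁ g))) = D.swap.σ (φ (restrict D.L₁ g)) :=
    D.swap.restrict_σ _
  rw [rest, map_mul, h1, map_mul, D.swap.map_σ, ← map_mul, D.restrict_mul_restrict]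

/-- Every element of the kernel is the product of elements of the two parts. -/
theorem list_prod_tw_mul_list_prod_tw (g : φ.ker) :
    (D.L₁.map fun i => D.tw i (g.1 i)).prod *
      (D.L₂.map fun i => D.swap.tw i (D.rest g.1 i)).prod = g := by
  apply Subtype.ext
  have h1 : φ g.1 = 1 := g.2
  have h2 : restrict D.L₂ (D.swap.σ (φ (restrict D.L₁ g.1))) = D.swap.σ (φ (restrict D.L₁ g.1)) :=
    D.swap.restrict_σ _
  have h3 := D.swap.coe_list_prod_tw (D.rest g.1)
  rw [swap_L₁, D.map_restrict_rest, h1, map_one, inv_one, mul_one] at h3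
  rw [Subgroup.coe_mul, D.coe_list_prod_tw, h3, rest, map_mul, h2, mul_assoc,
    inv_mul_cancel_left, D.restrict_mul_restrict]

/-- The kernel is generated by finitely many elements. -/
theorem exists_surjective [Finite ι] [Finite Y] (D : Splitting φ) :
    ∃ (n : ℕ) (p : FreeGroup (Fin n) →* φ.ker), Function.Surjective p := by
  let s : Set φ.ker := (⋃ i : ι, Set.range fun y : Y => D.tw i (FreeGroup.of y)) ∪
    ⋃ i : ι, Set.range fun y : Y => D.swap.tw i (FreeGroup.of y)
  have hs : s.Finite := (Set.finite_iUnion fun i => Set.finite_range _).union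
    (Set.finite_iUnion fun i => Set.finite_range _)
  obtain ⟨n, f, hf⟩ := hs.fin_embedding
  refine ⟨n, FreeGroup.lift f, ?_⟩
  rw [← MonoidHom.range_eq_top, FreeGroup.range_lift_eq_closure, hf, eq_top_iff]
  have key : ∀ t : FreeGroup Y →* φ.ker, (∀ y, t (FreeGroup.of y) ∈ s) →
      ∀ u, t u ∈ Subgroup.closure s := by
    intro t ht u
    have : t.range ≤ Subgroup.closure s := by
      have h : t = FreeGroup.lift fun y => t (FreeGroup.of y) := by
        ext1 y
        simp
      rw [h, FreeGroup.range_lift_eq_closure]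
      refine Subgroup.closure_mono ?_
      rintro _ ⟨y, rfl⟩
      exact ht y
    exact this ⟨u, rfl⟩
  intro g _
  rw [← D.list_prod_tw_mul_list_prod_tw g]
  refine mul_mem (Subgroup.list_prod_mem _ fun z hz => ?_)
    (Subgroup.list_prod_mem _ fun z hz => ?_) <;>
  · obtain ⟨i, -, rfl⟩ := List.mem_map.1 hz
    refine key _ (fun y => ?_) _
    simp [s]

variable {π : FreeGroup X →* φ.ker} (hπ : Function.Surjective π)

/-- A word that represents a given element of the kernel. -/
noncomputable def normalForm (g : φ.ker) : FreeGroup X :=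
  (D.L₁.map fun i => liftHom hπ (D.tw i) (g.1 i)).prod *
    (D.L₂.map fun i => liftHom hπ (D.swap.tw i) (D.rest g.1 i)).prod

theorem map_normalForm (g : φ.ker) : π (D.normalForm hπ g) = g := by
  rw [normalForm, map_mul, map_list_prod, map_list_prod, List.map_map, List.map_map]
  simpa only [Function.comp_def, map_liftHom] using D.list_prod_tw_mul_list_prod_tw g

variable {Θ : Type*} {sz : Θ → ℕ}

theorem mk_normalForm (g : Θ → φ.ker) :
    ((fun θ => D.normalForm hπ (g θ) : Θ → FreeGroup X) : (Θ → FreeGroup X) ⧸ quadNull π sz) =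
      D.half hπ sz (fun θ => (g θ).1) * D.swap.half hπ sz (fun θ => D.rest (g θ).1) := by
  rw [half, half, ← mk_list_prod_liftHom, ← mk_list_prod_liftHom]
  rfl

variable [Finite Y] [DecidableEq Y] [Finite X] [DecidableEq X]

/-- Let `a, c` and `b, e` be the components of `p` and `q`, and `d` the image of `σ' (ζ q)`, with
`σ'` the section in the second part. The second component of the product is `d c d⁻¹ e`, so it
suffices that `b d` commutes with `c`. As `d` is inverse to the image of `σ (ζ q)`, `b d` comes from
`f q * (σ (ζ q))⁻¹`, which `φ` kills on the first part, while `φ` kills `rest` on the second. -/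
theorem half_mul_half_rest (f : FreeGroup X →* (ι → FreeGroup Y)) (hf : ∀ x, φ (f x) = 1)
    {p q : Θ → FreeGroup X} (hp : p ∈ linFam X sz) (hq : q ∈ linFam X sz) :
    D.half hπ sz (fun θ => f (p θ * q θ)) *
      D.swap.half hπ sz (fun θ => D.rest (f (p θ * q θ))) =
    D.half hπ sz (fun θ => f (p θ)) * D.swap.half hπ sz (fun θ => D.rest (f (p θ))) *
      (D.half hπ sz (fun θ => f (q θ)) * D.swap.half hπ sz (fun θ => D.rest (f (q θ)))) := by
  obtain ⟨ζ, hζ⟩ : ∃ ζ : FreeGroup X →* FreeAb l, ∀ x, ζ x = φ (restrict D.L₁ (f x)) :=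
    ⟨φ.comp ((restrict D.L₁).comp f), fun _ => rfl⟩
  have hrest : ∀ x, D.rest (f x) = D.swap.σ (ζ x) * f x := fun x => by rw [hζ, rest]
  have hgp : IsLin sz (fun θ => f (p θ)) := isLin_map f hp
  have hgq : IsLin sz (fun θ => f (q θ)) := isLin_map f hq
  have hσq : IsLin sz (fun θ => D.σ (ζ (q θ))) := isLin_map (D.σ.comp ζ) hq
  have hσp' : IsLin sz (fun θ => D.swap.σ (ζ (p θ))) := isLin_map (D.swap.σ.comp ζ) hp
  have hσq' : IsLin sz (fun θ => D.swap.σ (ζ (q θ))) := isLin_map (D.swap.σ.comp ζ) hq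
  have hrp : IsLin sz (fun θ => D.rest (f (p θ))) := by
    simpa only [hrest] using hσp'.mul hgp
  have hrq : IsLin sz (fun θ => D.rest (f (q θ))) := by
    simpa only [hrest] using hσq'.mul hgq
  have h1 : D.half hπ sz (fun θ => f (p θ * q θ)) =
      D.half hπ sz (fun θ => f (p θ)) * D.half hπ sz (fun θ => f (q θ)) := by
    rw [← D.half_mul hπ hgp hgq]
    simp only [map_mul]
  have h2 : D.swap.half hπ sz (fun θ => D.rest (f (p θ * q θ))) =
      D.swap.half hπ sz (fun θ => D.swap.σ (ζ (q θ))) *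
        D.swap.half hπ sz (fun θ => D.rest (f (p θ))) *
        (D.swap.half hπ sz (fun θ => D.swap.σ (ζ (q θ))))⁻¹ *
        D.swap.half hπ sz (fun θ => D.rest (f (q θ))) := by
    rw [← D.swap.half_inv hπ hσq', ← D.swap.half_mul hπ hσq' hrp,
      ← D.swap.half_mul hπ (hσq'.mul hrp) hσq'.inv,
      ← D.swap.half_mul hπ ((hσq'.mul hrp).mul hσq'.inv) hrq]
    congr 1
    funext θ
    rw [hrest, hrest, hrest, map_mul ζ, mul_comm (ζ _), map_mul, map_mul]
    group
  have h3 : D.half hπ sz (fun θ => f (q θ)) *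
      D.swap.half hπ sz (fun θ => D.swap.σ (ζ (q θ))) =
      D.half hπ sz (fun θ => f (q θ) * (D.σ (ζ (q θ)))⁻¹) := by
    have := D.half_σ_mul_half_swap_σ hπ ζ hq
    rw [mul_eq_one_iff_inv_eq] at this
    rw [D.half_mul hπ hgq hσq.inv, D.half_inv hπ hσq, this]
  have h6 : ∀ θ, φ (restrict D.L₁ (f (q θ) * (D.σ (ζ (q θ)))⁻¹)) = 1 := fun θ => by
    rw [map_mul, map_inv, D.restrict_σ, map_mul, map_inv, D.map_σ, hζ, mul_inv_cancel]
  have h7 : ∀ θ, φ (restrict D.L₂ (D.rest (f (p θ)))) = 1 := fun θ => by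
    rw [D.map_restrict_rest, hf]
  have h4 := (D.half_commute_half hπ (hgq.mul hσq.inv) hrp h6 h7).eq
  rw [← h3] at h4
  rw [h1, h2]
  generalize D.half hπ sz (fun θ => f (p θ)) = a at *
  generalize D.half hπ sz (fun θ => f (q θ)) = b at *
  generalize D.swap.half hπ sz (fun θ => D.swap.σ (ζ (q θ))) = d at *
  generalize D.swap.half hπ sz (fun θ => D.rest (f (p θ))) = c at *
  generalize D.swap.half hπ sz (fun θ => D.rest (f (q θ))) = e at *
  calc a * b * (d * c * d⁻¹ * e) = a * (b * d * c) * d⁻¹ * e := by group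
    _ = a * (c * (b * d)) * d⁻¹ * e := by rw [h4]
    _ = a * c * (b * e) := by group

/-- Normal forms multiply up to quadratic area. -/
theorem mk_normalForm_mul {p q : Θ → FreeGroup X} (hp : p ∈ linFam X sz) (hq : q ∈ linFam X sz) :
    ((fun θ => D.normalForm hπ (π (p θ * q θ)) : Θ → FreeGroup X) :
      (Θ → FreeGroup X) ⧸ quadNull π sz) =
      ((fun θ => D.normalForm hπ (π (p θ)) : Θ → FreeGroup X) :
        (Θ → FreeGroup X) ⧸ quadNull π sz) *
      ((fun θ => D.normalForm hπ (π (q θ)) : Θ → FreeGroup X) :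
        (Θ → FreeGroup X) ⧸ quadNull π sz) := by
  rw [mk_normalForm, mk_normalForm, mk_normalForm]
  exact D.half_mul_half_rest hπ (φ.ker.subtype.comp π) (fun x => (π x).2) hp hq

theorem exists_areaLE (D : Splitting φ) (hπ : Function.Surjective π) :
    ∃ R : Set (FreeGroup X), R.Finite ∧ (∀ r ∈ R, π r = 1) ∧
    ∃ C : ℕ, ∀ w, π w = 1 → AreaLE R (C * w.norm ^ 2) w := by
  refine exists_areaLE_of_triangles π (D.normalForm hπ) (D.map_normalForm hπ) ?_
  have h1 : (fun p : FreeGroup X × FreeGroup X => p.1) ∈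
      linFam X (fun p : FreeGroup X × FreeGroup X => p.1.norm + p.2.norm) :=
    ⟨1, fun θ => by simp⟩
  have h2 : (fun p : FreeGroup X × FreeGroup X => p.2) ∈
      linFam X (fun p : FreeGroup X × FreeGroup X => p.1.norm + p.2.norm) :=
    ⟨1, fun θ => by simp⟩
  have h3 := D.mk_normalForm_mul hπ h1 h2
  rw [eq_comm, ← mul_inv_eq_one] at h3
  exact (QuotientGroup.eq_one_iff (N := quadNull π _) (_ : FreeGroup X × FreeGroup X →
    FreeGroup X)).1 h3

end Splitting

/-! ### Existence of a splitting, and the theorem. -/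

/-- Both parts have at least `r / 2` factors, rounded down, which is at least `l` and at least 2. -/
theorem exists_splitting {r l m : ℕ} (hr : 4 ≤ r) (hl : 2 * l ≤ r)
    (φ : (Fin r → FreeGroup (Fin m)) →* FreeAb l)
    (hφ : ∀ i, Function.Surjective (factor φ i)) : Nonempty (Splitting φ) := by
  choose y hy using fun i j => hφ i (FreeAb.basis j)
  refine ⟨{
    y := y
    factor_y := hy
    L₁ := (List.finRange r).filter fun i => decide (i.1 < r / 2)
    L₂ := (List.finRange r).filter fun i => decide (r / 2 ≤ i.1)
    nodup₁ := (List.nodup_finRange r).filter _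
    nodup₂ := (List.nodup_finRange r).filter _
    mem_iff := fun i => by simp
    ne₁ := fun i _ => ?_
    ne₂ := fun i _ => ?_
    τ₁ := fun j => ⟨j.1, by omega⟩
    τ₂ := fun j => ⟨r / 2 + j.1, by omega⟩
    inj₁ := fun j j' h => by simpa [Fin.ext_iff] using h
    inj₂ := fun j j' h => by simpa [Fin.ext_iff] using h
    mem₁ := fun j => by simp; omega
    mem₂ := fun j => by simp }⟩
  · by_cases h : i.1 = 0
    · exact ⟨⟨1, by omega⟩, by simp; omega, by simp [Fin.ext_iff, h]⟩
    · exact ⟨⟨0, by omega⟩, by simp; omega, by simp [Fin.ext_iff]; omega⟩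
  · by_cases h : i.1 = r / 2
    · exact ⟨⟨r / 2 + 1, by omega⟩, by simp, by simp [Fin.ext_iff, h]⟩
    · exact ⟨⟨r / 2, by omega⟩, by simp, by simp [Fin.ext_iff]; omega⟩

theorem mainTheorem4 (r l m : ℕ) (hr : 4 ≤ r) (hl : (⌈(l : ℚ) / 2⌉ : ℚ) ≤ (r : ℚ) / 4)
    (hm : 1 ≤ m) (φ : (Fin r → FreeGroup (Fin m)) →* Multiplicative (Fin l → ℤ))
    (hφ : ∀ i : Fin r, Function.Surjective
      (φ.comp (MonoidHom.mulSingle (fun _ : Fin r => FreeGroup (Fin m)) i))) :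
    HasQuadraticDehnFunction φ.ker := by
  have hl' : 2 * l ≤ r := by
    have h : (2 * l : ℚ) ≤ r := by linarith [Int.le_ceil ((l : ℚ) / 2)]
    exact_mod_cast h
  obtain ⟨D⟩ := exists_splitting hr hl' φ hφ
  obtain ⟨n, p, hp⟩ := D.exists_surjective
  let x : FreeGroup (Fin m) := FreeGroup.of ⟨0, hm⟩
  let e : FreeGroup (Fin m) →* Multiplicative ℤ := FreeGroup.lift fun _ => Multiplicative.ofAdd 1
  have hex : e x = Multiplicative.ofAdd 1 := FreeGroup.lift_apply_of
  let i : Fin 4 → Fin r := Fin.castLE hr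
  have hi : Function.Injective i := Fin.castLE_injective hr
  -- Surjectivity on the factor `t` cancels the value of `φ` on `x` in the factor `s`. With four
  -- distinct factors this yields two elements of the kernel with disjoint supports, separated by
  -- exponent sums in the factors `i 0` and `i 2`.
  have hpair : ∀ s t : Fin r, ∃ z, Pi.mulSingle s x * Pi.mulSingle t z ∈ φ.ker := by
    intro s t
    obtain ⟨z, hz⟩ := hφ t (φ (Pi.mulSingle s x))⁻¹
    refine ⟨z, ?_⟩
    rw [MonoidHom.mem_ker, map_mul]
    exact mul_eq_one_iff_eq_inv'.2 hz
  obtain ⟨z, hz⟩ := hpair (i 0) (i 1)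
  obtain ⟨z', hz'⟩ := hpair (i 2) (i 3)
  let f : Fin 4 → φ.ker →* Multiplicative ℤ := fun s =>
    (e.comp (Pi.evalMonoidHom _ (i s))).comp φ.ker.subtype
  have hne : ∀ {s t : Fin 4}, s ≠ t → ∀ u v : FreeGroup (Fin m),
      Commute (Pi.mulSingle (i s) u : Fin r → FreeGroup (Fin m)) (Pi.mulSingle (i t) v) := by
    intro s t hst u v
    refine commute_mulSingle ?_
    rw [Pi.mulSingle_eq_of_ne (hi.ne hst)]
    exact Commute.one_right _
  refine hasQuadraticDehnFunction_of_areaLE hp (fun X _ _ π hπ => D.exists_areaLE hπ)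
    (f 0) (f 2) (a := ⟨_, hz⟩) (b := ⟨_, hz'⟩) ?_ ?_ ?_ ?_ ?_
  · apply Subtype.ext
    exact Commute.mul_left
      (Commute.mul_right (hne (by decide) _ _) (hne (by decide) _ _))
      (Commute.mul_right (hne (by decide) _ _) (hne (by decide) _ _))
  · simp [f, hex, hi.eq_iff]
  · simp [f, hi.eq_iff]
  · simp [f, hi.eq_iff]
  · simp [f, hex, hi.eq_iff]
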